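/- Consider a state-space model with states $x_s\in\mathbb{R}^d$ and observations in a measurable space, given by an initial density $p(x_0)$, transition densities $p(x_s\mid x_{s-1})$ and observation densities $p(y_s\mid x_s)$, and a proposal with densities $r_0(x_0)$ and $r_s(x_s\mid x_{s-1},y_s)$. Fix $t$ and observations $y_{1:t}$ with $p(y_{1:t})>0$ and $p(y_{1:s})<\infty$ for all $s\le t$, and assume that $r_0(x_0)>0$ where $p(x_0)>0$, and $r_s(x_s\mid x_{s-1},y_s)>0$ where $p(x_s\mid x_{s-1})\,p(y_s\mid x_s)>0$, $1\le s\le t$. Run sequential Monte Carlo (SMC) with $N\ge 1$ particles: draw $x_0^1,\dots,x_0^N\sim r_0$ independently, with weights $w_0^i=p(x_0^i)/r_0(x_0^i)$; for $s=1,\dots,t$, independently for each $i$, draw an ancestor index $a_s^i$ with $\Pr(a_s^i=j)\propto w_{s-1}^j$ and a particle $x_s^i\sim r_s(\,\cdot\mid x_{s-1}^{a_s^i},y_s)$, with weight $w_s^i=p(y_s\mid x_s^i)\,p(x_s^i\mid x_{s-1}^{a_s^i})/r_s(x_s^i\mid x_{s-1}^{a_s^i},y_s)$. (If all weights vanish at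 some time, the estimate below is $0$ and the run counts as having no output.) Let $\hat p(y_{1:t})=\prod_{s=0}^t \frac1N\sum_{i=1}^N w_s^i$; the factor at $s=0$ equals $1$ if $r_0=p$. The implicit filtering distribution induced by SMC, that is, the law of $x_t^B$ where $B=i$ with probability proportional to $w_t^i$ (on runs with $\hat p(y_{1:t})>0$), has the density $$\tilde q(x_t\mid y_{1:t})=p(x_t,y_{1:t})\;\mathbb{E}\left[\frac{1}{\hat p(y_{1:t})}\right],$$ where the expectation is over all the random variables of SMC other than the selected state $x_t$: a trajectory $x_{0:t}$ that ends in $x_t$ is retained as one of the $N$ particles at each time, its past $x_{0:t-1}$ has the density $p(x_{0:t-1}\mid x_t,y_{1:t})$, and all the other particles and their ancestors are drawn as in SMC. As $N\to\infty$, $\tilde q(\cdot\mid y_{1:t})$ converges to the true filtering posterior density $p(x_t\mid y_{1:t})=p(x_t,y_{1:t})/p(y_{1:t})$ in total variation: $$\int\left|\tilde q(x_t\mid y_{1:t})-p(x_t\mid y_{1:t})\right|dx_t\to 0.$$ If moreover the weight functions $p(x_0)/r_0(x_0)$ and $p(y_s\mid x_s)\,p(x_s\mid x_{s-1})/r_s(x_s\mid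 x_{s-1},y_s)$, $1\le s\le t$, are bounded, then $\tilde q(x_t\mid y_{1:t})\to p(x_t\mid y_{1:t})$ for almost every $x_t$. -/

import Mathlib

open MeasureTheory Filter Topology
open scoped NNReal ENNReal

noncomputable section

namespace ParticleFilter

/-- The latent state space `ℝ^d`. -/
abbrev State (d : ℕ) : Type := EuclideanSpace ℝ (Fin d)

/-- A state-space model with states in `ℝ^d` and observations in a measurable space `Y`, given by
its densities: states have densities with respect to Lebesgue measure, observations with respect
to a reference measure `ν`. Inputs and parameters enter through the dependence on time. -/
structure Model (d : ℕ) (Y : Type*) [MeasurableSpace Y] (ν : Measure Y) where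
  /-- `p(x₀)` -/
  init : State d → ℝ≥0
  /-- `trans s x x'` is `p(x_s = x' | x_{s-1} = x)`, for `s ≥ 1` -/
  trans : ℕ → State d → State d → ℝ≥0
  /-- `obs s x v` is `p(y_s = v | x_s = x)`, for `s ≥ 1` -/
  obs : ℕ → State d → Y → ℝ≥0
  measurable_init : Measurable init
  measurable_trans : ∀ s, Measurable fun p : State d × State d => trans s p.1 p.2
  measurable_obs : ∀ s, Measurable fun p : State d × Y => obs s p.1 p.2
  lintegral_init : ∫⁻ x, init x = 1
  lintegral_trans : ∀ s x, ∫⁻ x', trans s x x' = 1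
  lintegral_obs : ∀ s x, ∫⁻ v, obs s x v ∂ν = 1

/-- A proposal `r₀(x₀) ∏ r_s(x_s | x_{s-1}, y_s)`, given by its densities. Its parameters enter
through the dependence on time. -/
structure Proposal (d : ℕ) (Y : Type*) where
  /-- `r₀(x₀)` -/
  init : State d → ℝ≥0
  /-- `step s x v x'` is `r_s(x_s = x' | x_{s-1} = x, y_s = v)`, for `s ≥ 1` -/
  step : ℕ → State d → Y → State d → ℝ≥0
  measurable_init : Measurable init
  measurable_step : ∀ s v, Measurable fun p : State d × State d => step s p.1 v p.2
  lintegral_init : ∫⁻ x, init x = 1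
  lintegral_step : ∀ s x v, ∫⁻ x', step s x v x' = 1

variable {d : ℕ} {Y : Type*} [MeasurableSpace Y] {ν : Measure Y}

/-! ### The target -/

/-- `p(x_{0:t}, y_{1:t}) = p(x₀) ∏_{s=1}^t p(x_s | x_{s-1}) p(y_s | x_s)`. -/
def Model.joint (m : Model d Y ν) (y : ℕ → Y) (t : ℕ) (x : Fin (t + 1) → State d) : ℝ≥0 :=
  m.init (x 0) * ∏ s : Fin t,
    (m.trans (s + 1) (x s.castSucc) (x s.succ) * m.obs (s + 1) (x s.succ) (y (s + 1)))

/-- `p(x_t, y_{1:t})`, the integral of `p(x_{0:t}, y_{1:t})` over `x_{0:t-1}`. -/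
def Model.marginal (m : Model d Y ν) (y : ℕ → Y) (t : ℕ) (x : State d) : ℝ≥0∞ :=
  ∫⁻ past : Fin t → State d, m.joint y t (Fin.snoc (α := fun _ => State d) past x)

/-- The marginal likelihood `p(y_{1:t})`. -/
def Model.likelihood (m : Model d Y ν) (y : ℕ → Y) (t : ℕ) : ℝ≥0∞ :=
  ∫⁻ x : Fin (t + 1) → State d, m.joint y t x

/-- The filtering posterior density `p(x_t | y_{1:t}) = p(x_t, y_{1:t}) / p(y_{1:t})`. -/
def Model.posterior (m : Model d Y ν) (y : ℕ → Y) (t : ℕ) (x : State d) : ℝ≥0∞ :=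
  m.marginal y t x / m.likelihood y t

/-! ### Sequential Monte Carlo with `N = n + 1` particles -/

/-- `w₀(x₀) = p(x₀) / r₀(x₀)`. -/
def weightInit (m : Model d Y ν) (r : Proposal d Y) (x : State d) : ℝ≥0 :=
  m.init x / r.init x

/-- `w_s = p(y_s | x_s) p(x_s | x_{s-1}) / r_s(x_s | x_{s-1}, y_s)` at `x_{s-1} = x`, `x_s = x'`. -/
def weight (m : Model d Y ν) (r : Proposal d Y) (y : ℕ → Y) (s : ℕ) (x x' : State d) : ℝ≥0 :=
  m.obs s x' (y s) * m.trans s x x' / r.step s x (y s) x'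

/-- The `n + 1` particles at one time, each with its (unnormalized) weight. -/
abbrev Cloud (d n : ℕ) : Type := Fin (n + 1) → State d × ℝ≥0

/-- The average weight `(1/N) ∑ᵢ wⁱ`. -/
def Cloud.meanWeight {n : ℕ} (c : Cloud d n) : ℝ≥0 :=
  (∑ i, (c i).2) / (n + 1 : ℕ)

/-- The normalized weight `wʲ / ∑ₗ wˡ`; uniform, by convention, if all weights vanish. -/
def Cloud.normWeight {n : ℕ} (c : Cloud d n) (j : Fin (n + 1)) : ℝ≥0 :=
  if ∑ l, (c l).2 = 0 then ((n + 1 : ℕ) : ℝ≥0)⁻¹ else (c j).2 / ∑ l, (c l).2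

/-- The law of one particle at time `0` with its weight: `x₀ ∼ r₀`, `w₀ = w₀(x₀)`. -/
def particleInit (m : Model d Y ν) (r : Proposal d Y) : Measure (State d × ℝ≥0) :=
  (volume.withDensity fun x => (r.init x : ℝ≥0∞)).map fun x => (x, weightInit m r x)

/-- The law of one new particle at time `s` with its weight, given the weighted particles `c` at
time `s - 1`: the ancestor is `j` with probability proportional to its weight, the particle is
drawn from `r_s(· | xʲ, y_s)`, and it is weighted by `w_s`. -/
def particleStep (m : Model d Y ν) (r : Proposal d Y) (y : ℕ → Y) (s : ℕ) {n : ℕ}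
    (c : Cloud d n) : Measure (State d × ℝ≥0) :=
  ∑ j, (c.normWeight j : ℝ≥0∞) •
    (volume.withDensity fun x' => (r.step s (c j).1 (y s) x' : ℝ≥0∞)).map
      fun x' => (x', weight m r y s (c j).1 x')

/-- What a run of SMC keeps at time `s`: the running estimate `∏_{k ≤ s} (1/N) ∑ᵢ w_kⁱ` and the
current weighted particles. -/
abbrev Run (d n : ℕ) : Type := ℝ≥0 × Cloud d n

/-- The law of an SMC run up to time `t`: all particles are drawn independently at each time, given
the previous ones. The first component of the run is the estimate `p̂(y_{1:t})`. -/
def smcLaw (m : Model d Y ν) (r : Proposal d Y) (y : ℕ → Y) (n : ℕ) : ℕ → Measure (Run d n)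
  | 0 => (Measure.pi fun _ : Fin (n + 1) => particleInit m r).map fun c : Cloud d n => (c.meanWeight, c)
  | s + 1 => (smcLaw m r y n s).bind fun ω =>
      (Measure.pi fun _ : Fin (n + 1) => particleStep m r y (s + 1) ω.2).map
        fun c : Cloud d n => (ω.1 * c.meanWeight, c)

/-- The law of an SMC run up to time `t` in which the trajectory `z = z_{0:t}` is retained:
particle `0` follows `z`, and all the other particles and all their ancestors are drawn as in SMC. -/
def retainedLaw (m : Model d Y ν) (r : Proposal d Y) (y : ℕ → Y) (n : ℕ) :
    (t : ℕ) → (Fin (t + 1) → State d) → Measure (Run d n)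
  | 0, z => (Measure.pi fun i : Fin (n + 1) =>
      if i = 0 then Measure.dirac (z 0, weightInit m r (z 0)) else particleInit m r).map
        fun c : Cloud d n => (c.meanWeight, c)
  | s + 1, z => (retainedLaw m r y n s (Fin.init z)).bind fun ω =>
      (Measure.pi fun i : Fin (n + 1) =>
        if i = 0 then
          Measure.dirac (z (Fin.last (s + 1)),
            weight m r y (s + 1) (z (Fin.last s).castSucc) (z (Fin.last (s + 1))))
        else particleStep m r y (s + 1) ω.2).map
          fun c : Cloud d n => (ω.1 * c.meanWeight, c)

/-- The law of a state drawn from the output of SMC, that is, of `x_tᴮ` where `B = i` with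
probability proportional to `w_tⁱ`. Runs with `p̂(y_{1:t}) = 0` output nothing. -/
def outputLaw (m : Model d Y ν) (r : Proposal d Y) (y : ℕ → Y) (n t : ℕ) : Measure (State d) :=
  (smcLaw m r y n t).bind fun ω =>
    if ω.1 = 0 then 0 else ∑ i, (ω.2.normWeight i : ℝ≥0∞) • Measure.dirac (ω.2 i).1

/-- `E[1 / p̂(y_{1:t})]` over all the random variables of SMC other than the retained trajectory
`z = z_{0:t}`. -/
def expInvGivenPath (m : Model d Y ν) (r : Proposal d Y) (y : ℕ → Y) (n t : ℕ)
    (z : Fin (t + 1) → State d) : ℝ≥0∞ :=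
  ∫⁻ ω, (ω.1 : ℝ≥0∞)⁻¹ ∂(retainedLaw m r y n t z)

/-- `E[1 / p̂(y_{1:t})]` over all the random variables of SMC other than the retained state `x` at
time `t`: the rest of the retained trajectory has the density
`p(x_{0:t-1} | x_t, y_{1:t}) = p(x_{0:t}, y_{1:t}) / p(x_t, y_{1:t})`. -/
def expInvGivenState (m : Model d Y ν) (r : Proposal d Y) (y : ℕ → Y) (n t : ℕ)
    (x : State d) : ℝ≥0∞ :=
  ∫⁻ past : Fin t → State d,
    (m.joint y t (Fin.snoc (α := fun _ => State d) past x) / m.marginal y t x) *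
      expInvGivenPath m r y n t (Fin.snoc (α := fun _ => State d) past x)

/-- The implicit filtering density `q̃(x_t | y_{1:t}) = p(x_t, y_{1:t}) E[1 / p̂(y_{1:t})]`. -/
def implicitDensity (m : Model d Y ν) (r : Proposal d Y) (y : ℕ → Y) (n t : ℕ)
    (x : State d) : ℝ≥0∞ :=
  m.marginal y t x * expInvGivenState m r y n t x

end ParticleFilter

end

/-!
The law of the output is computed by a change of measure, step by step in time. Selecting a particle
with probability proportional to its weight cancels the random normalization of the weights against
the mean weight that enters the likelihood estimate `p̂`, so that, after multiplication with `p̂`, the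
law of a run with a selected particle becomes that of a trajectory with density `p(x_{0:t}, y_{1:t})`
around which the remaining particles are drawn as in SMC (`lintegral_smcLaw_select`, by induction on
time, for functions that are invariant under permutations of the particles). Testing this against
`1 / p̂` gives the density `q̃` (`outputLaw_eq_withDensity`).

For a retained trajectory `z`, write `E_z` for the expectation over the other random variables, and
`L` for `p(y_{1:t})`. The retained particle is one among `N` at each time and enters the mean of `p̂`
linearly, so that `E_z[p̂] ≤ L + O(1/N)` for almost every `z`, without any assumption on moments
(`lintegral_estimate_retainedLaw_le`). The bound `1/p̂ ≥ 2/L - p̂/L²` by the tangent line at `L` then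
shows that asymptotically `E_z[1/p̂] ≥ 1/L`. By dominated convergence, the shortfall of `q̃` below the
posterior tends to zero almost everywhere (`ae_tendsto_posterior_sub`), and again by dominated
convergence it does so in `L¹`. As `q̃` has at most the mass of the posterior, this is convergence in
total variation (`tendsto_lintegral_implicitDensity`).

Convergence almost everywhere needs an upper bound on `E_z[1/p̂]` too. Given the past, the estimates at
one time are sums of independent terms. If the weights are bounded, the negative exponential moments
of `p̂` are close to those of `L`, uniformly in `z` (`exists_lintegral_expNeg_estimate_le`), and
`p̂ < a` has, for each `a < L`, a probability under `E_z` that decays faster than any power of `N`. On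
that event `1/p̂` is at most `N^{t+1}` over the product of the weights of `z`
(`expInvGivenPath_le`), and since `p(x_{0:t}, y_{1:t})` divided by this product is the proposal
density, which is integrable, the event contributes a vanishing multiple of a function of `x_t` that
is finite almost everywhere (`ae_tendsto_implicitDensity`).
-/

open MeasureTheory Filter Topology
open scoped NNReal ENNReal

noncomputable section

namespace ParticleFilter

/-! ### Product measures -/

section ProductMeasures

variable {ι α β : Type*} [Fintype ι] [MeasurableSpace α] [MeasurableSpace β]

theorem measurable_measure_pi {μ : ι → α → Measure β} (hμ : ∀ i, Measurable (μ i))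
    [∀ i a, IsProbabilityMeasure (μ i a)] :
    Measurable fun a => Measure.pi fun i => μ i a := by
  refine Measurable.measure_of_isPiSystem_of_isProbabilityMeasure
    (S := Set.pi Set.univ '' Set.pi Set.univ fun _ : ι => {s : Set β | MeasurableSet s})
    generateFrom_pi.symm isPiSystem_pi ?_
  rintro _ ⟨s, hs, rfl⟩
  simp only [Measure.pi_pi]
  exact Finset.measurable_prod _ fun i _ =>
    (Measure.measurable_coe (hs i (Set.mem_univ i))).comp (hμ i)

theorem ae_pi_eval {μ : ι → Measure α} [∀ i, IsProbabilityMeasure (μ i)] (i : ι) {p : α → Prop}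
    (hp : ∀ᵐ a ∂μ i, p a) : ∀ᵐ c ∂Measure.pi μ, p (c i) :=
  (measurePreserving_eval μ i).quasiMeasurePreserving.ae hp

theorem lintegral_pi_eval {μ : ι → Measure α} [∀ i, IsProbabilityMeasure (μ i)] (i : ι)
    {f : α → ℝ≥0∞} (hf : Measurable f) : ∫⁻ c, f (c i) ∂Measure.pi μ = ∫⁻ a, f a ∂μ i :=
  (measurePreserving_eval μ i).lintegral_comp hf

theorem lintegral_pi_prod {μ : ι → Measure α} [∀ i, IsProbabilityMeasure (μ i)]
    {f : ι → α → ℝ≥0∞} (hf : ∀ i, Measurable (f i)) :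
    ∫⁻ c, ∏ i, f i (c i) ∂Measure.pi μ = ∏ i, ∫⁻ a, f i a ∂μ i := by
  have hind : ProbabilityTheory.iIndepFun (fun i (c : ι → α) => f i (c i)) (Measure.pi μ) :=
    ProbabilityTheory.iIndepFun_pi fun i => (hf i).aemeasurable
  rw [ProbabilityTheory.lintegral_prod_eq_prod_lintegral_of_indepFun _ _ hind
    fun i => (hf i).comp (measurable_pi_apply i)]
  exact Finset.prod_congr rfl fun i _ => lintegral_pi_eval i (hf i)

theorem lintegral_pi_comp_perm (μ : Measure α) [IsProbabilityMeasure μ] (σ : Equiv.Perm ι)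
    {F : (ι → α) → ℝ≥0∞} (hF : Measurable F) :
    ∫⁻ c, F (c ∘ σ) ∂Measure.pi (fun _ : ι => μ) = ∫⁻ c, F c ∂Measure.pi fun _ : ι => μ := by
  have hσ : Measurable fun c : ι → α => c ∘ σ := by
    exact measurable_pi_lambda _ fun i => measurable_pi_apply _
  have h : Measure.pi (fun _ : ι => μ) = (Measure.pi fun _ : ι => μ).map fun c => c ∘ σ := by
    refine Measure.pi_eq fun s hs => ?_
    rw [Measure.map_apply hσ (MeasurableSet.univ_pi hs)]
    have : (fun c : ι → α => c ∘ σ) ⁻¹' Set.pi Set.univ s =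
        Set.pi Set.univ fun i => s (σ.symm i) := by
      ext c
      simp only [Set.mem_preimage, Set.mem_univ_pi, Function.comp]
      exact ⟨fun h i => by simpa using h (σ.symm i), fun h i => by simpa using h (σ i)⟩
    rw [this, Measure.pi_pi]
    exact Equiv.prod_comp σ.symm fun i => μ (s i)
  conv_rhs => rw [h]
  rw [lintegral_map hF hσ]

variable [DecidableEq ι]

/-- The law of a family of independent random variables, one of which, with index `i₀`, is frozen
at the value `a`, while all the others have the law `μ`. -/
def pinnedPi (i₀ : ι) (a : α) (μ : Measure α) : Measure (ι → α) :=
  Measure.pi fun i => if i = i₀ then Measure.dirac a else μ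

instance (p : Prop) [Decidable p] (a : α) (μ : Measure α) [IsProbabilityMeasure μ] :
    IsProbabilityMeasure (if p then Measure.dirac a else μ) := by
  split_ifs <;> infer_instance

instance (i₀ : ι) (a : α) (μ : Measure α) [IsProbabilityMeasure μ] :
    IsProbabilityMeasure (pinnedPi i₀ a μ) := by
  unfold pinnedPi; infer_instance

theorem measurable_pinnedPi {γ : Type*} [MeasurableSpace γ] (i₀ : ι) {a : γ → α}
    {μ : γ → Measure α} (ha : Measurable a) (hμ : Measurable μ) [∀ c, IsProbabilityMeasure (μ c)] :
    Measurable fun c => pinnedPi i₀ (a c) (μ c) := by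
  unfold pinnedPi
  refine measurable_measure_pi (μ := fun i c => if i = i₀ then Measure.dirac (a c) else μ c)
    fun i => ?_
  by_cases h : i = i₀
  · simp only [h, if_true]
    exact Measure.measurable_dirac.comp ha
  · simpa only [h, if_false] using hμ

/-- Integrating an independent family of random variables amounts to drawing the variable with
index `i₀` first. -/
theorem lintegral_pi_eq_lintegral_pinnedPi (i₀ : ι) (μ : Measure α) [IsProbabilityMeasure μ]
    {F : (ι → α) → ℝ≥0∞} (hF : Measurable F) :
    ∫⁻ c, F c ∂Measure.pi (fun _ : ι => μ) = ∫⁻ a, ∫⁻ c, F c ∂pinnedPi i₀ a μ ∂μ := by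
  have hm : Measurable fun a => pinnedPi i₀ a μ :=
    measurable_pinnedPi i₀ measurable_id measurable_const
  have h : Measure.pi (fun _ : ι => μ) = μ.bind fun a => pinnedPi i₀ a μ := by
    refine Measure.pi_eq fun s hs => ?_
    rw [Measure.bind_apply (MeasurableSet.univ_pi hs) hm.aemeasurable]
    have key : ∀ a, pinnedPi i₀ a μ (Set.pi Set.univ s) =
        (s i₀).indicator 1 a * ∏ i ∈ Finset.univ.erase i₀, μ (s i) := fun a => by
      rw [pinnedPi, Measure.pi_pi, ← Finset.mul_prod_erase _ _ (Finset.mem_univ i₀)]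
      congr 1
      · simp [Measure.dirac_apply' _ (hs i₀)]
      · exact Finset.prod_congr rfl fun i hi => by rw [if_neg (Finset.ne_of_mem_erase hi)]
    simp_rw [key]
    rw [lintegral_mul_const _ (measurable_one.indicator (hs i₀)), lintegral_indicator_one (hs i₀),
      ← Finset.mul_prod_erase _ (fun i => μ (s i)) (Finset.mem_univ i₀)]
  rw [h, Measure.lintegral_bind hm.aemeasurable hF.aemeasurable]

theorem ae_pinnedPi_eq [MeasurableSingletonClass α] (i₀ : ι) (a : α) (μ : Measure α)
    [IsProbabilityMeasure μ] : ∀ᵐ c ∂pinnedPi i₀ a μ, c i₀ = a := by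
  refine ae_pi_eval (p := fun b => b = a) i₀ ?_
  rw [if_pos rfl]
  simp [ae_dirac_eq]

theorem ae_pinnedPi_of_ne (i₀ : ι) (a : α) {μ : Measure α} [IsProbabilityMeasure μ] {i : ι}
    (hi : i ≠ i₀) {p : α → Prop} (hp : ∀ᵐ b ∂μ, p b) : ∀ᵐ c ∂pinnedPi i₀ a μ, p (c i) := by
  refine ae_pi_eval i ?_
  rwa [if_neg hi]

theorem lintegral_pinnedPi_eval [MeasurableSingletonClass α] (i₀ : ι) (a : α) (μ : Measure α)
    [IsProbabilityMeasure μ] (i : ι) {f : α → ℝ≥0∞} (hf : Measurable f) :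
    ∫⁻ c, f (c i) ∂pinnedPi i₀ a μ = if i = i₀ then f a else ∫⁻ b, f b ∂μ := by
  rw [pinnedPi, lintegral_pi_eval i hf]
  split_ifs <;> simp

end ProductMeasures

/-! ### Measurable families of probability measures -/

section Families

variable {α β γ : Type*} [MeasurableSpace α] [MeasurableSpace β] [MeasurableSpace γ]

theorem measurable_lintegral_family {μ : α → Measure β} (hμ : Measurable μ)
    [∀ a, IsProbabilityMeasure (μ a)] {f : α × β → ℝ≥0∞} (hf : Measurable f) :
    Measurable fun a => ∫⁻ b, f (a, b) ∂μ a := by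
  let κ : ProbabilityTheory.Kernel α β := ⟨μ, hμ⟩
  have : ProbabilityTheory.IsMarkovKernel κ :=
    ⟨fun a => inferInstanceAs (IsProbabilityMeasure (μ a))⟩
  exact hf.lintegral_kernel_prod_right' (κ := κ)

theorem measurable_map_family {μ : α → Measure β} (hμ : Measurable μ)
    [∀ a, IsProbabilityMeasure (μ a)] {f : α × β → γ} (hf : Measurable f) :
    Measurable fun a => (μ a).map fun b => f (a, b) := by
  refine Measure.measurable_of_measurable_coe _ fun s hs => ?_
  have h := measurable_lintegral_family hμ
    (f := fun p => (f ⁻¹' s).indicator 1 p) (measurable_one.indicator (hf hs))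
  convert h using 2 with a
  have ha : Measurable fun b => f (a, b) := hf.comp measurable_prodMk_left
  rw [Measure.map_apply ha hs, ← lintegral_indicator_one (ha hs)]
  rfl

theorem measurable_bind_family {μ : α → Measure β} (hμ : Measurable μ)
    [∀ a, IsProbabilityMeasure (μ a)] {η : α × β → Measure γ} (hη : Measurable η) :
    Measurable fun a => (μ a).bind fun b => η (a, b) := by
  refine Measure.measurable_of_measurable_coe _ fun s hs => ?_
  have h := measurable_lintegral_family hμ
    (f := fun p => η p s) ((Measure.measurable_coe hs).comp hη)
  convert h using 2 with a
  exact Measure.bind_apply hs (hη.comp measurable_prodMk_left).aemeasurable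

theorem ae_bind_of_ae {μ : Measure α} {η : α → Measure β} (hη : Measurable η) {p : β → Prop}
    (hp : MeasurableSet {b | p b}) (h : ∀ᵐ a ∂μ, ∀ᵐ b ∂η a, p b) : ∀ᵐ b ∂μ.bind η, p b := by
  rw [ae_iff]
  refine (Measure.bind_apply hp.compl hη.aemeasurable).trans ?_
  exact (lintegral_eq_zero_iff ((Measure.measurable_coe hp.compl).comp hη)).2 h

end Families

/-! ### Trajectories -/

theorem volume_preserving_snoc (d t : ℕ) :
    MeasurePreserving (fun p : State d × (Fin t → State d) =>
      Fin.snoc (α := fun _ => State d) p.2 p.1) := by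
  have h := (volume_preserving_piFinSuccAbove (fun _ : Fin (t + 1) => State d) (Fin.last t)).symm
  convert h using 1
  funext p
  simp [MeasurableEquiv.piFinSuccAbove, Fin.insertNthEquiv]

theorem measurable_snoc {d t : ℕ} : Measurable fun p : State d × (Fin t → State d) =>
    (Fin.snoc (α := fun _ => State d) p.2 p.1 : Fin (t + 1) → State d) :=
  (volume_preserving_snoc d t).measurable

theorem lintegral_trajectory {d t : ℕ} {F : (Fin (t + 1) → State d) → ℝ≥0∞} (hF : Measurable F) :
    ∫⁻ z, F z = ∫⁻ x, ∫⁻ past : Fin t → State d, F (Fin.snoc (α := fun _ => State d) past x) := by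
  rw [← (volume_preserving_snoc d t).lintegral_comp hF, Measure.volume_eq_prod]
  exact lintegral_prod _ (hF.comp measurable_snoc).aemeasurable

theorem lintegral_trajectory' {d t : ℕ} {F : (Fin (t + 1) → State d) → ℝ≥0∞} (hF : Measurable F) :
    ∫⁻ z, F z = ∫⁻ past : Fin t → State d, ∫⁻ x, F (Fin.snoc (α := fun _ => State d) past x) := by
  rw [← (volume_preserving_snoc d t).lintegral_comp hF, Measure.volume_eq_prod]
  exact lintegral_prod_symm _ (hF.comp measurable_snoc).aemeasurable

theorem lintegral_trajectory_zero {d : ℕ} {F : State d → ℝ≥0∞} (hF : Measurable F) :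
    ∫⁻ z : Fin (0 + 1) → State d, F (z 0) = ∫⁻ x, F x :=
  (volume_preserving_funUnique (Fin 1) (State d)).lintegral_comp hF

theorem ae_ae_snoc {d t : ℕ} {p : (Fin (t + 1) → State d) → Prop} (hp : ∀ᵐ z, p z) :
    ∀ᵐ x, ∀ᵐ past : Fin t → State d, p (Fin.snoc (α := fun _ => State d) past x) := by
  have h := (volume_preserving_snoc d t).quasiMeasurePreserving.ae hp
  rw [Measure.volume_eq_prod] at h
  exact Measure.ae_ae_of_ae_prod h

theorem measurable_finInit {d t : ℕ} :
    Measurable fun z : Fin (t + 1) → State d => (Fin.init z : Fin t → State d) :=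
  measurable_pi_lambda _ fun _ => measurable_pi_apply _

theorem ae_finInit {d t : ℕ} {p : (Fin t → State d) → Prop} (hp : ∀ᵐ z, p z) :
    ∀ᵐ z : Fin (t + 1) → State d, p (Fin.init z) := by
  have h := (volume_preserving_piFinSuccAbove (fun _ : Fin (t + 1) => State d) (Fin.last t))
  have h2 := h.quasiMeasurePreserving.ae (p := fun q => p q.2)
    (by rw [Measure.volume_eq_prod]; exact Measure.quasiMeasurePreserving_snd.ae hp)
  filter_upwards [h2] with z hz
  convert hz using 1
  funext i
  simp [MeasurableEquiv.piFinSuccAbove, Fin.insertNthEquiv, Fin.init]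

variable {d n : ℕ} {Y : Type*} [MeasurableSpace Y] {ν : Measure Y}

/-! ### The model -/

section Model

variable (m : Model d Y ν) (r : Proposal d Y) (y : ℕ → Y)

/-- The density `p(x_s = x' | x_{s-1} = x) p(y_s | x_s = x')` of one step of the target. -/
def Model.step (s : ℕ) (x x' : State d) : ℝ≥0 :=
  m.trans s x x' * m.obs s x' (y s)

theorem Model.measurable_step (s : ℕ) :
    Measurable fun p : State d × State d => m.step y s p.1 p.2 :=
  (m.measurable_trans s).mul
    ((m.measurable_obs s).comp (measurable_snd.prodMk measurable_const))

theorem Model.joint_zero (z : Fin 1 → State d) : m.joint y 0 z = m.init (z 0) := by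
  simp [Model.joint]

theorem Model.joint_succ (s : ℕ) (z : Fin (s + 2) → State d) :
    m.joint y (s + 1) z = m.joint y s (Fin.init z) *
      m.step y (s + 1) (z (Fin.last s).castSucc) (z (Fin.last (s + 1))) := by
  simp only [Model.joint, Model.step, Fin.prod_univ_castSucc (n := s), mul_assoc, Fin.init,
    Fin.val_last, Fin.val_castSucc, Fin.succ_last, Fin.succ_castSucc, Fin.castSucc_zero]

theorem Model.measurable_joint (t : ℕ) : Measurable (m.joint y t) := by
  induction t with
  | zero =>
    simp only [funext fun z => m.joint_zero y z]
    exact m.measurable_init.comp (measurable_pi_apply _)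
  | succ s ih =>
    simp only [funext fun z => m.joint_succ y s z]
    have h : Measurable fun z : Fin (s + 2) → State d =>
        (z (Fin.last s).castSucc, z (Fin.last (s + 1))) :=
      (measurable_pi_apply _).prodMk (measurable_pi_apply _)
    exact (ih.comp measurable_finInit).mul ((m.measurable_step y (s + 1)).comp h)

/-- Integration against `p(x_{0:s+1}, y_{1:s+1})`, the last state being integrated out first. -/
theorem Model.lintegral_joint_succ (s : ℕ) {F : (Fin (s + 2) → State d) → ℝ≥0∞}
    (hF : Measurable F) :
    ∫⁻ z, m.joint y (s + 1) z * F z = ∫⁻ z : Fin (s + 1) → State d, m.joint y s z *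
      ∫⁻ x', m.step y (s + 1) (z (Fin.last s)) x' * F (Fin.snoc (α := fun _ => State d) z x') := by
  have hj : Measurable fun z => (m.joint y (s + 1) z : ℝ≥0∞) * F z :=
    (m.measurable_joint y (s + 1)).coe_nnreal_ennreal.mul hF
  rw [lintegral_trajectory' hj]
  refine lintegral_congr fun z => ?_
  have hz : Measurable fun x' => (Fin.snoc (α := fun _ => State d) z x' : Fin (s + 2) → State d) :=
    measurable_snoc.comp (measurable_id.prodMk measurable_const)
  have hst : Measurable fun x' => m.step y (s + 1) (z (Fin.last s)) x' :=
    (m.measurable_step y (s + 1)).comp (measurable_const.prodMk measurable_id)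
  have h : Measurable fun x' => (m.step y (s + 1) (z (Fin.last s)) x' : ℝ≥0∞) *
      F (Fin.snoc (α := fun _ => State d) z x') := hst.coe_nnreal_ennreal.mul (hF.comp hz)
  rw [← lintegral_const_mul _ h]
  refine lintegral_congr fun x' => ?_
  rw [m.joint_succ, Fin.init_snoc, Fin.snoc_last, Fin.snoc_castSucc, ENNReal.coe_mul, mul_assoc]

theorem measurable_weightInit : Measurable (weightInit m r) :=
  m.measurable_init.div r.measurable_init

theorem measurable_weight (s : ℕ) :
    Measurable fun p : State d × State d => weight m r y s p.1 p.2 :=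
  (((m.measurable_obs s).comp (measurable_snd.prodMk measurable_const)).mul
    (m.measurable_trans s)).div (r.measurable_step s (y s))

theorem proposal_mul_weightInit (hr₀ : ∀ x, m.init x ≠ 0 → r.init x ≠ 0) (x : State d) :
    r.init x * weightInit m r x = m.init x := by
  by_cases h : m.init x = 0
  · simp [weightInit, h]
  · rw [weightInit, mul_div_cancel₀ _ (hr₀ x h)]

theorem proposal_mul_weight {s : ℕ}
    (hr : ∀ x x', m.trans s x x' * m.obs s x' (y s) ≠ 0 → r.step s x (y s) x' ≠ 0)
    (x x' : State d) : r.step s x (y s) x' * weight m r y s x x' = m.step y s x x' := by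
  by_cases h : m.trans s x x' * m.obs s x' (y s) = 0
  · rw [weight, mul_comm (m.obs _ _ _), h, Model.step, h, zero_div, mul_zero]
  · rw [weight, mul_comm (m.obs _ _ _), mul_div_cancel₀ _ (hr x x' h), Model.step]

end Model

/-! ### Weighted particles -/

section Cloud

theorem Cloud.measurable_sum_weights : Measurable fun c : Cloud d n => ∑ l, (c l).2 :=
  Finset.measurable_sum _ fun l _ => measurable_snd.comp (measurable_pi_apply l)

theorem Cloud.measurable_meanWeight : Measurable (Cloud.meanWeight : Cloud d n → ℝ≥0) :=
  Cloud.measurable_sum_weights.div_const _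

theorem Cloud.measurable_normWeight (j : Fin (n + 1)) :
    Measurable fun c : Cloud d n => c.normWeight j :=
  Measurable.ite (Cloud.measurable_sum_weights (measurableSet_singleton 0)) measurable_const
    ((measurable_snd.comp (measurable_pi_apply j)).div Cloud.measurable_sum_weights)

theorem Cloud.sum_normWeight (c : Cloud d n) : ∑ j, c.normWeight j = 1 := by
  unfold Cloud.normWeight
  split_ifs with h
  · rw [Finset.sum_const, Finset.card_univ, Fintype.card_fin, nsmul_eq_mul,
      mul_inv_cancel₀ (by positivity)]
  · rw [← Finset.sum_div, div_self h]

theorem Cloud.meanWeight_mul_normWeight (c : Cloud d n) (j : Fin (n + 1)) :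
    c.meanWeight * c.normWeight j = (c j).2 / (n + 1 : ℕ) := by
  unfold Cloud.meanWeight Cloud.normWeight
  split_ifs with h
  · have : (c j).2 = 0 := (Finset.sum_eq_zero_iff.1 h) j (Finset.mem_univ j)
    rw [h, this, zero_div, zero_mul]
  · field_simp

/-- The mean weight times the self-normalized average of `f` is the unnormalized average, also
when all weights vanish. -/
theorem Cloud.meanWeight_mul_sum (c : Cloud d n) (f : Fin (n + 1) → ℝ≥0∞) :
    (c.meanWeight : ℝ≥0∞) * ∑ j, (c.normWeight j : ℝ≥0∞) * f j =
      ((n + 1 : ℕ) : ℝ≥0∞)⁻¹ * ∑ j, ((c j).2 : ℝ≥0∞) * f j := by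
  simp only [Finset.mul_sum]
  refine Finset.sum_congr rfl fun j _ => ?_
  rw [← mul_assoc, ← ENNReal.coe_mul, c.meanWeight_mul_normWeight, ← mul_assoc,
    ENNReal.coe_div (by positivity), ENNReal.div_eq_inv_mul, ENNReal.coe_natCast]

theorem Cloud.meanWeight_comp (c : Cloud d n) (σ : Equiv.Perm (Fin (n + 1))) :
    Cloud.meanWeight (d := d) (n := n) (c ∘ σ) = c.meanWeight := by
  unfold Cloud.meanWeight
  rw [← Equiv.sum_comp σ fun i => (c i).2]
  rfl

theorem Cloud.normWeight_comp (c : Cloud d n) (σ : Equiv.Perm (Fin (n + 1))) (j : Fin (n + 1)) :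
    Cloud.normWeight (d := d) (n := n) (c ∘ σ) j = c.normWeight (σ j) := by
  unfold Cloud.normWeight
  rw [← Equiv.sum_comp σ fun i => (c i).2]
  rfl

end Cloud

/-! ### The laws of a single particle -/

section Particle

variable (m : Model d Y ν) (r : Proposal d Y) (y : ℕ → Y)

instance : IsProbabilityMeasure (particleInit m r) := by
  have : IsProbabilityMeasure (volume.withDensity fun x => (r.init x : ℝ≥0∞)) :=
    ⟨by rw [withDensity_apply _ MeasurableSet.univ, Measure.restrict_univ, r.lintegral_init]⟩
  exact Measure.isProbabilityMeasure_map
    (measurable_id.prodMk (measurable_weightInit m r)).aemeasurable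

theorem lintegral_particleInit {f : State d × ℝ≥0 → ℝ≥0∞} (hf : Measurable f) :
    ∫⁻ a, f a ∂particleInit m r = ∫⁻ x, r.init x * f (x, weightInit m r x) := by
  have hg : Measurable fun x => (x, weightInit m r x) :=
    measurable_id.prodMk (measurable_weightInit m r)
  rw [particleInit, lintegral_map hf hg]
  exact lintegral_withDensity_eq_lintegral_mul _ r.measurable_init.coe_nnreal_ennreal (hf.comp hg)

theorem lintegral_weighted_particleInit (hr₀ : ∀ x, m.init x ≠ 0 → r.init x ≠ 0)
    {f : State d × ℝ≥0 → ℝ≥0∞} (hf : Measurable f) :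
    ∫⁻ a, a.2 * f a ∂particleInit m r = ∫⁻ x, m.init x * f (x, weightInit m r x) := by
  have hf' : Measurable fun a : State d × ℝ≥0 => (a.2 : ℝ≥0∞) * f a :=
    measurable_snd.coe_nnreal_ennreal.mul hf
  rw [lintegral_particleInit m r hf']
  refine lintegral_congr fun x => ?_
  rw [← mul_assoc, ← ENNReal.coe_mul, proposal_mul_weightInit m r hr₀]

theorem lintegral_particleStep (s : ℕ) (c : Cloud d n) {f : State d × ℝ≥0 → ℝ≥0∞}
    (hf : Measurable f) :
    ∫⁻ a, f a ∂particleStep m r y s c = ∑ j, (c.normWeight j : ℝ≥0∞) *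
      ∫⁻ x', r.step s (c j).1 (y s) x' * f (x', weight m r y s (c j).1 x') := by
  rw [particleStep, lintegral_finsetSum_measure]
  refine Finset.sum_congr rfl fun j _ => ?_
  have hg : Measurable fun x' => (x', weight m r y s (c j).1 x') :=
    measurable_id.prodMk ((measurable_weight m r y s).comp (measurable_const.prodMk measurable_id))
  have hs : Measurable fun x' => r.step s (c j).1 (y s) x' :=
    (r.measurable_step s (y s)).comp (measurable_const.prodMk measurable_id)
  rw [lintegral_smul_measure, lintegral_map hf hg, smul_eq_mul]
  exact congrArg _
    (lintegral_withDensity_eq_lintegral_mul _ hs.coe_nnreal_ennreal (hf.comp hg))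

theorem lintegral_weighted_particleStep {s : ℕ}
    (hr : ∀ x x', m.trans s x x' * m.obs s x' (y s) ≠ 0 → r.step s x (y s) x' ≠ 0)
    (c : Cloud d n) {f : State d × ℝ≥0 → ℝ≥0∞} (hf : Measurable f) :
    ∫⁻ a, a.2 * f a ∂particleStep m r y s c = ∑ j, (c.normWeight j : ℝ≥0∞) *
      ∫⁻ x', m.step y s (c j).1 x' * f (x', weight m r y s (c j).1 x') := by
  have hf' : Measurable fun a : State d × ℝ≥0 => (a.2 : ℝ≥0∞) * f a :=
    measurable_snd.coe_nnreal_ennreal.mul hf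
  rw [lintegral_particleStep m r y s c hf']
  refine Finset.sum_congr rfl fun j _ => ?_
  congr 1
  refine lintegral_congr fun x => ?_
  rw [← mul_assoc, ← ENNReal.coe_mul, proposal_mul_weight m r y hr]

instance (s : ℕ) (c : Cloud d n) : IsProbabilityMeasure (particleStep m r y s c) := by
  refine ⟨?_⟩
  rw [← lintegral_one, lintegral_particleStep m r y s c measurable_const]
  simp only [mul_one, r.lintegral_step]
  exact_mod_cast c.sum_normWeight

theorem measurable_particleStep (s : ℕ) :
    Measurable fun c : Cloud d n => particleStep m r y s c := by
  refine Measure.measurable_of_measurable_coe _ fun S hS => ?_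
  have hind : Measurable (S.indicator (1 : State d × ℝ≥0 → ℝ≥0∞)) := measurable_one.indicator hS
  simp_rw [← lintegral_indicator_one hS, lintegral_particleStep m r y s _ hind]
  refine Finset.measurable_sum _ fun j _ =>
    (Cloud.measurable_normWeight j).coe_nnreal_ennreal.mul ?_
  have hj : Measurable fun p : Cloud d n × State d => ((p.1 j).1, p.2) :=
    (measurable_fst.comp ((measurable_pi_apply j).comp measurable_fst)).prodMk measurable_snd
  exact Measurable.lintegral_prod_right'
    (f := fun p : Cloud d n × State d => (r.step s (p.1 j).1 (y s) p.2 : ℝ≥0∞) *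
      S.indicator 1 (p.2, weight m r y s (p.1 j).1 p.2))
    (((r.measurable_step s (y s)).comp hj).coe_nnreal_ennreal.mul
      (hind.comp (measurable_snd.prodMk ((measurable_weight m r y s).comp hj))))

theorem particleStep_comp (s : ℕ) (c : Cloud d n) (σ : Equiv.Perm (Fin (n + 1))) :
    particleStep m r y s (n := n) (c ∘ σ) = particleStep m r y s c := by
  unfold particleStep
  simp only [Cloud.normWeight_comp, Function.comp]
  exact Equiv.sum_comp σ fun j => (c.normWeight j : ℝ≥0∞) •
    (volume.withDensity fun x' => (r.step s (c j).1 (y s) x' : ℝ≥0∞)).map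
      fun x' => (x', weight m r y s (c j).1 x')

end Particle

/-! ### The laws of SMC runs -/

section Run

variable (m : Model d Y ν) (r : Proposal d Y) (y : ℕ → Y) (n)

theorem measurable_run {γ : Type*} [MeasurableSpace γ] {p : γ → ℝ≥0} {c : γ → Cloud d n}
    (hp : Measurable p) (hc : Measurable c) :
    Measurable fun g => ((p g * (c g).meanWeight, c g) : Run d n) :=
  (hp.mul (Cloud.measurable_meanWeight.comp hc)).prodMk hc

theorem measurable_initRun : Measurable fun c : Cloud d n => ((c.meanWeight, c) : Run d n) :=
  Cloud.measurable_meanWeight.prodMk measurable_id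

theorem measurable_smcStep (s : ℕ) : Measurable fun ω : Run d n =>
    (Measure.pi fun _ : Fin (n + 1) => particleStep m r y s ω.2).map
      fun c : Cloud d n => ((ω.1 * c.meanWeight, c) : Run d n) := by
  refine measurable_map_family (f := fun p : Run d n × Cloud d n =>
    ((p.1.1 * p.2.meanWeight, p.2) : Run d n)) (measurable_measure_pi fun _ => ?_) ?_
  · exact (measurable_particleStep m r y s).comp measurable_snd
  · exact measurable_run n (measurable_fst.comp measurable_fst) measurable_snd

/-- The law of the next time step of a run in which particle `0` is frozen at `a`. -/
def pinnedStep (s : ℕ) (a : State d × ℝ≥0) (ω : Run d n) : Measure (Run d n) :=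
  (pinnedPi 0 a (particleStep m r y s ω.2)).map fun c : Cloud d n => (ω.1 * c.meanWeight, c)

theorem measurable_pinnedStep (s : ℕ) : Measurable fun p : (State d × ℝ≥0) × Run d n =>
    pinnedStep n m r y s p.1 p.2 := by
  refine measurable_map_family (f := fun p : ((State d × ℝ≥0) × Run d n) × Cloud d n =>
    ((p.1.2.1 * p.2.meanWeight, p.2) : Run d n)) (measurable_pinnedPi 0 measurable_fst ?_) ?_
  · exact (measurable_particleStep m r y s).comp (measurable_snd.comp measurable_snd)
  · exact measurable_run n (measurable_fst.comp (measurable_snd.comp measurable_fst)) measurable_snd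

theorem measurable_pinnedStep' (s : ℕ) (a : State d × ℝ≥0) :
    Measurable (pinnedStep n m r y s a) :=
  (measurable_pinnedStep n m r y s).comp measurable_prodMk_left

instance (s : ℕ) (a : State d × ℝ≥0) (ω : Run d n) :
    IsProbabilityMeasure (pinnedStep n m r y s a ω) :=
  Measure.isProbabilityMeasure_map (measurable_run n measurable_const measurable_id).aemeasurable

theorem retainedLaw_zero (z : Fin 1 → State d) : retainedLaw m r y n 0 z =
    (pinnedPi 0 (z 0, weightInit m r (z 0)) (particleInit m r)).map
      fun c : Cloud d n => (c.meanWeight, c) := rfl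

/-- The last state of a trajectory with the weight of its last step. -/
def lastParticle (s : ℕ) (z : Fin (s + 2) → State d) : State d × ℝ≥0 :=
  (z (Fin.last (s + 1)),
    weight m r y (s + 1) (z (Fin.last s).castSucc) (z (Fin.last (s + 1))))

theorem measurable_lastParticle (s : ℕ) : Measurable (lastParticle m r y s) := by
  have h : Measurable fun z : Fin (s + 2) → State d =>
      (z (Fin.last s).castSucc, z (Fin.last (s + 1))) :=
    (measurable_pi_apply _).prodMk (measurable_pi_apply _)
  exact (measurable_pi_apply _).prodMk ((measurable_weight m r y (s + 1)).comp h)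

theorem retainedLaw_succ (s : ℕ) (z : Fin (s + 2) → State d) : retainedLaw m r y n (s + 1) z =
    (retainedLaw m r y n s (Fin.init z)).bind
      (pinnedStep n m r y (s + 1) (lastParticle m r y s z)) := rfl

theorem retainedLaw_spec (t : ℕ) : Measurable (retainedLaw m r y n t) ∧
    ∀ z, IsProbabilityMeasure (retainedLaw m r y n t z) := by
  induction t with
  | zero =>
    refine ⟨?_, fun z => Measure.isProbabilityMeasure_map (measurable_initRun n).aemeasurable⟩
    simp only [funext fun z => retainedLaw_zero n m r y z]
    refine measurable_map_family (f := fun p : (Fin 1 → State d) × Cloud d n =>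
      ((p.2.meanWeight, p.2) : Run d n)) (measurable_pinnedPi 0 ?_ measurable_const)
      ((measurable_initRun n).comp measurable_snd)
    exact (measurable_id.prodMk (measurable_weightInit m r)).comp (measurable_pi_apply 0)
  | succ s ih =>
    obtain ⟨hm, hp⟩ := ih
    have hst := measurable_pinnedStep n m r y (s + 1)
    constructor
    · simp only [funext fun z => retainedLaw_succ n m r y s z]
      have : ∀ z : Fin (s + 2) → State d,
        IsProbabilityMeasure (retainedLaw m r y n s (Fin.init z)) := fun z => hp _
      exact measurable_bind_family (μ := fun z : Fin (s + 2) → State d => retainedLaw m r y n s (Fin.init z))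
        (hm.comp measurable_finInit)
        (η := fun p : (Fin (s + 2) → State d) × Run d n =>
          pinnedStep n m r y (s + 1) (lastParticle m r y s p.1) p.2)
        (hst.comp (((measurable_lastParticle m r y s).comp measurable_fst).prodMk measurable_snd))
    · intro z
      rw [retainedLaw_succ]
      refine ⟨?_⟩
      rw [Measure.bind_apply MeasurableSet.univ (measurable_pinnedStep' n m r y _ _).aemeasurable]
      have := hp (Fin.init z)
      simp

theorem measurable_retainedLaw (t : ℕ) : Measurable (retainedLaw m r y n t) :=
  (retainedLaw_spec n m r y t).1

instance (t : ℕ) (z : Fin (t + 1) → State d) : IsProbabilityMeasure (retainedLaw m r y n t z) :=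
  (retainedLaw_spec n m r y t).2 z

instance (t : ℕ) : IsProbabilityMeasure (smcLaw m r y n t) := by
  induction t with
  | zero => exact Measure.isProbabilityMeasure_map (measurable_initRun n).aemeasurable
  | succ s ih =>
    refine ⟨?_⟩
    rw [smcLaw, Measure.bind_apply MeasurableSet.univ (measurable_smcStep n m r y _).aemeasurable]
    have : ∀ ω : Run d n, ((Measure.pi fun _ : Fin (n + 1) => particleStep m r y (s + 1) ω.2).map
        fun c : Cloud d n => ((ω.1 * c.meanWeight, c) : Run d n)) Set.univ = 1 := fun ω => by
      have : IsProbabilityMeasure ((Measure.pi fun _ : Fin (n + 1) =>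
          particleStep m r y (s + 1) ω.2).map
            fun c : Cloud d n => ((ω.1 * c.meanWeight, c) : Run d n)) :=
        Measure.isProbabilityMeasure_map (measurable_run n measurable_const measurable_id).aemeasurable
      exact measure_univ
    simp [this]

variable {F : Run d n → ℝ≥0∞}

theorem lintegral_smcLaw_zero (hF : Measurable F) : ∫⁻ ω, F ω ∂smcLaw m r y n 0 =
    ∫⁻ c, F (Cloud.meanWeight c, c) ∂Measure.pi fun _ : Fin (n + 1) => particleInit m r := by
  rw [smcLaw, lintegral_map hF (measurable_initRun n)]

theorem lintegral_smcLaw_succ (hF : Measurable F) (s : ℕ) :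
    ∫⁻ ω, F ω ∂smcLaw m r y n (s + 1) = ∫⁻ ω, ∫⁻ c, F (ω.1 * Cloud.meanWeight c, c)
      ∂(Measure.pi fun _ : Fin (n + 1) => particleStep m r y (s + 1) ω.2) ∂smcLaw m r y n s := by
  rw [smcLaw, Measure.lintegral_bind (measurable_smcStep n m r y _).aemeasurable hF.aemeasurable]
  exact lintegral_congr fun ω =>
    lintegral_map hF (measurable_run n measurable_const measurable_id)

theorem lintegral_retainedLaw_zero (hF : Measurable F) (z : Fin 1 → State d) :
    ∫⁻ ω, F ω ∂retainedLaw m r y n 0 z = ∫⁻ c, F (Cloud.meanWeight c, c)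
      ∂pinnedPi 0 (z 0, weightInit m r (z 0)) (particleInit m r) := by
  rw [retainedLaw_zero, lintegral_map hF (measurable_initRun n)]

theorem lintegral_retainedLaw_succ (hF : Measurable F) (s : ℕ) (z : Fin (s + 2) → State d) :
    ∫⁻ ω, F ω ∂retainedLaw m r y n (s + 1) z = ∫⁻ ω, ∫⁻ c, F (ω.1 * Cloud.meanWeight c, c)
      ∂pinnedPi 0 (lastParticle m r y s z) (particleStep m r y (s + 1) ω.2)
        ∂retainedLaw m r y n s (Fin.init z) := by
  rw [retainedLaw_succ, Measure.lintegral_bind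
    (measurable_pinnedStep' n m r y _ _).aemeasurable hF.aemeasurable]
  exact lintegral_congr fun ω =>
    lintegral_map hF (measurable_run n measurable_const measurable_id)

end Run

/-! ### Change of measure between SMC and SMC with a retained trajectory -/

section ChangeOfMeasure

/-- Sampling independent weighted particles and selecting one of them, with total mass the mean
weight, amounts to sampling one particle, weighting it, and completing it with independent
particles, as seen by functions that do not depend on the order of the particles. -/
theorem lintegral_pi_select (μ : Measure (State d × ℝ≥0)) [IsProbabilityMeasure μ]
    {G : Cloud d n × State d → ℝ≥0∞} (hG : Measurable G)
    (hsymm : ∀ (c : Cloud d n) (σ : Equiv.Perm (Fin (n + 1))) x, G (c ∘ σ, x) = G (c, x)) :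
    ∫⁻ c : Cloud d n, (c.meanWeight : ℝ≥0∞) * ∑ i, (c.normWeight i : ℝ≥0∞) * G (c, (c i).1)
        ∂Measure.pi (fun _ : Fin (n + 1) => μ) =
      ∫⁻ a, a.2 * ∫⁻ c, G (c, a.1) ∂pinnedPi (0 : Fin (n + 1)) a μ ∂μ := by
  have hm : ∀ i, Measurable fun c : Cloud d n => ((c i).2 : ℝ≥0∞) * G (c, (c i).1) := fun i =>
    (measurable_snd.comp (measurable_pi_apply i)).coe_nnreal_ennreal.mul
      (hG.comp (measurable_id.prodMk (measurable_fst.comp (measurable_pi_apply i))))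
  have hi : ∀ i, ∫⁻ c : Cloud d n, ((c i).2 : ℝ≥0∞) * G (c, (c i).1)
      ∂Measure.pi (fun _ : Fin (n + 1) => μ) =
      ∫⁻ c : Cloud d n, ((c 0).2 : ℝ≥0∞) * G (c, (c 0).1)
        ∂Measure.pi (fun _ : Fin (n + 1) => μ) := fun i => by
    rw [← lintegral_pi_comp_perm μ (Equiv.swap 0 i) (hm 0)]
    refine lintegral_congr fun c => ?_
    have h0 : (c ∘ Equiv.swap 0 i) 0 = c i := by simp
    rw [h0, hsymm]
  simp_rw [Cloud.meanWeight_mul_sum]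
  rw [lintegral_const_mul _ (Finset.measurable_sum _ fun i _ => hm i),
    lintegral_finsetSum _ fun i _ => hm i, Finset.sum_congr rfl fun i _ => hi i, Finset.sum_const,
    Finset.card_univ, Fintype.card_fin, nsmul_eq_mul, ← mul_assoc,
    ENNReal.inv_mul_cancel (by positivity) (ENNReal.natCast_ne_top _), one_mul,
    lintegral_pi_eq_lintegral_pinnedPi 0 μ (hm 0)]
  refine lintegral_congr fun a => ?_
  have hGa : Measurable fun c : Cloud d n => G (c, a.1) :=
    hG.comp (measurable_id.prodMk measurable_const)
  rw [← lintegral_const_mul _ hGa]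
  refine lintegral_congr_ae ?_
  filter_upwards [ae_pinnedPi_eq (0 : Fin (n + 1)) a μ] with c hc
  rw [hc]

variable (m : Model d Y ν) (r : Proposal d Y) (y : ℕ → Y)

/-- After multiplication with `p̂(y_{1:t})`, an SMC run with a selected particle has the law of a
trajectory with density `p(x_{0:t}, y_{1:t})` and of a run that retains it, as seen by functions `G`
that do not depend on the order of the particles. -/
theorem lintegral_smcLaw_select (hr₀ : ∀ x, m.init x ≠ 0 → r.init x ≠ 0) (t : ℕ)
    (hr : ∀ s, 1 ≤ s → s ≤ t → ∀ x x',
      m.trans s x x' * m.obs s x' (y s) ≠ 0 → r.step s x (y s) x' ≠ 0)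
    {G : Run d n × State d → ℝ≥0∞} (hG : Measurable G)
    (hsymm : ∀ p (c : Cloud d n) (σ : Equiv.Perm (Fin (n + 1))) x,
      G ((p, c ∘ σ), x) = G ((p, c), x)) :
    ∫⁻ ω, ω.1 * ∑ i, (ω.2.normWeight i : ℝ≥0∞) * G (ω, (ω.2 i).1) ∂smcLaw m r y n t =
      ∫⁻ z, m.joint y t z * ∫⁻ ω, G (ω, z (Fin.last t)) ∂retainedLaw m r y n t z := by
  have hLHS : ∀ {G : Run d n × State d → ℝ≥0∞}, Measurable G → Measurable fun ω : Run d n =>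
      (ω.1 : ℝ≥0∞) * ∑ i, (ω.2.normWeight i : ℝ≥0∞) * G (ω, (ω.2 i).1) := fun hG =>
    measurable_fst.coe_nnreal_ennreal.mul <| Finset.measurable_sum _ fun i _ =>
      ((Cloud.measurable_normWeight i).comp measurable_snd).coe_nnreal_ennreal.mul <|
        hG.comp <| measurable_id.prodMk <|
          measurable_fst.comp ((measurable_pi_apply i).comp measurable_snd)
  induction t generalizing G with
  | zero =>
    have hG' : Measurable fun p : Cloud d n × State d =>
        G ((Cloud.meanWeight (d := d) (n := n) p.1, p.1), p.2) :=
      hG.comp (((measurable_initRun n).comp measurable_fst).prodMk measurable_snd)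
    rw [lintegral_smcLaw_zero n m r y (hLHS hG)]
    rw [lintegral_pi_select (particleInit m r) hG' fun c σ x => by
      rw [Cloud.meanWeight_comp, hsymm]]
    have hΦ : Measurable fun a : State d × ℝ≥0 => ∫⁻ c : Cloud d n, G ((c.meanWeight, c), a.1)
        ∂pinnedPi (0 : Fin (n + 1)) a (particleInit m r) :=
      measurable_lintegral_family
        (f := fun p : (State d × ℝ≥0) × Cloud d n =>
          G ((Cloud.meanWeight (d := d) (n := n) p.2, p.2), p.1.1))
        (measurable_pinnedPi 0 measurable_id measurable_const)
        (hG'.comp (measurable_snd.prodMk (measurable_fst.comp measurable_fst)))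
    rw [lintegral_weighted_particleInit m r hr₀ hΦ]
    refine (lintegral_trajectory_zero (m.measurable_init.coe_nnreal_ennreal.mul
      (hΦ.comp (measurable_id.prodMk (measurable_weightInit m r))))).symm.trans ?_
    refine lintegral_congr fun z => ?_
    have hGz : Measurable fun ω => G (ω, z (Fin.last 0)) :=
      hG.comp (measurable_id.prodMk measurable_const)
    rw [lintegral_retainedLaw_zero n m r y hGz, m.joint_zero]
    rfl
  | succ s ih =>
    have hG' : Measurable fun p : Run d n × (Cloud d n × State d) =>
        G ((p.1.1 * Cloud.meanWeight (d := d) (n := n) p.2.1, p.2.1), p.2.2) :=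
      hG.comp ((measurable_run n (measurable_fst.comp measurable_fst)
        (measurable_fst.comp measurable_snd)).prodMk (measurable_snd.comp measurable_snd))
    -- `Φ (ω, a)` integrates `G` over the next step of the run `ω` with particle `0` frozen at `a`
    let Φ : Run d n × (State d × ℝ≥0) → ℝ≥0∞ := fun q =>
      ∫⁻ c : Cloud d n, G ((q.1.1 * c.meanWeight, c), q.2.1)
        ∂pinnedPi (0 : Fin (n + 1)) q.2 (particleStep m r y (s + 1) q.1.2)
    have hΦ : Measurable Φ :=
      measurable_lintegral_family
        (f := fun p : (Run d n × (State d × ℝ≥0)) × Cloud d n =>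
          G ((p.1.1.1 * Cloud.meanWeight (d := d) (n := n) p.2, p.2), p.1.2.1))
        (measurable_pinnedPi (μ := fun q : Run d n × (State d × ℝ≥0) =>
          particleStep m r y (s + 1) q.1.2) 0 measurable_snd
            ((measurable_particleStep m r y (s + 1)).comp (measurable_snd.comp measurable_fst)))
        (hG'.comp ((measurable_fst.comp measurable_fst).prodMk
          (measurable_snd.prodMk (measurable_fst.comp (measurable_snd.comp measurable_fst)))))
    have hpair : Measurable fun p : (Run d n × State d) × State d => (p.1.2, p.2) :=
      (measurable_snd.comp measurable_fst).prodMk measurable_snd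
    have hΨ : Measurable fun p : (Run d n × State d) × State d =>
        (m.step y (s + 1) p.1.2 p.2 : ℝ≥0∞) *
          Φ (p.1.1, (p.2, weight m r y (s + 1) p.1.2 p.2)) :=
      ((m.measurable_step y (s + 1)).comp hpair).coe_nnreal_ennreal.mul
        (hΦ.comp ((measurable_fst.comp measurable_fst).prodMk
          (measurable_snd.prodMk ((measurable_weight m r y (s + 1)).comp hpair))))
    have hstep : ∀ ω : Run d n, ∫⁻ c, ((ω.1 * Cloud.meanWeight c : ℝ≥0) : ℝ≥0∞) *
        ∑ i, (Cloud.normWeight c i : ℝ≥0∞) * G ((ω.1 * Cloud.meanWeight c, c), (c i).1)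
          ∂(Measure.pi fun _ : Fin (n + 1) => particleStep m r y (s + 1) ω.2) =
        ω.1 * ∑ j, (ω.2.normWeight j : ℝ≥0∞) * ∫⁻ x', m.step y (s + 1) (ω.2 j).1 x' *
          Φ (ω, (x', weight m r y (s + 1) (ω.2 j).1 x')) := fun ω => by
      rw [← lintegral_weighted_particleStep m r y (hr (s + 1) (by simp) le_rfl) ω.2
        (f := fun a => Φ (ω, a)) (hΦ.comp measurable_prodMk_left)]
      have h := lintegral_pi_select (n := n) (particleStep m r y (s + 1) ω.2)
        (G := fun p => G ((ω.1 * Cloud.meanWeight (d := d) (n := n) p.1, p.1), p.2))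
        (hG'.comp measurable_prodMk_left) fun c σ x => by
          rw [Cloud.meanWeight_comp, hsymm]
      refine Eq.trans ?_ (congrArg (fun u => (ω.1 : ℝ≥0∞) * u) h)
      rw [← lintegral_const_mul' _ _ ENNReal.coe_ne_top]
      simp only [ENNReal.coe_mul, mul_assoc]
    rw [lintegral_smcLaw_succ n m r y (hLHS hG)]
    simp_rw [hstep]
    rw [ih (fun k hk hks => hr k hk (hks.trans s.le_succ))
      (G := fun p => ∫⁻ x', m.step y (s + 1) p.2 x' *
          Φ (p.1, (x', weight m r y (s + 1) p.2 x')))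
      hΨ.lintegral_prod_right' fun p c σ x => by simp only [Φ, particleStep_comp]]
    have hF : Measurable fun z : Fin (s + 2) → State d =>
        ∫⁻ ω, G (ω, z (Fin.last (s + 1))) ∂retainedLaw m r y n (s + 1) z :=
      measurable_lintegral_family (measurable_retainedLaw n m r y (s + 1))
        (f := fun p => G (p.2, p.1 (Fin.last (s + 1))))
        (hG.comp (measurable_snd.prodMk ((measurable_pi_apply _).comp measurable_fst)))
    rw [m.lintegral_joint_succ y s hF]
    refine lintegral_congr fun z => ?_
    congr 1
    have hswap : Measurable (Function.uncurry fun (ω : Run d n) (x' : State d) =>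
        (m.step y (s + 1) (z (Fin.last s)) x' : ℝ≥0∞) *
          Φ (ω, (x', weight m r y (s + 1) (z (Fin.last s)) x'))) :=
      hΨ.comp ((measurable_fst.prodMk measurable_const).prodMk measurable_snd)
    rw [lintegral_lintegral_swap hswap.aemeasurable]
    refine lintegral_congr fun x' => ?_
    have hGx : Measurable fun ω => G (ω, x') := hG.comp (measurable_id.prodMk measurable_const)
    rw [lintegral_const_mul' _ _ ENNReal.coe_ne_top, Fin.snoc_last,
      lintegral_retainedLaw_succ n m r y hGx]
    simp only [Φ, lastParticle, Fin.init_snoc, Fin.snoc_last, Fin.snoc_castSucc]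

end ChangeOfMeasure

/-! ### The law of the output of SMC -/

section Output

variable (m : Model d Y ν) (r : Proposal d Y) (y : ℕ → Y)

theorem Model.measurable_marginal (t : ℕ) : Measurable (m.marginal y t) :=
  ((m.measurable_joint y t).coe_nnreal_ennreal.comp measurable_snoc).lintegral_prod_right'

theorem Model.lintegral_marginal (t : ℕ) : ∫⁻ x, m.marginal y t x = m.likelihood y t :=
  (lintegral_trajectory (m.measurable_joint y t).coe_nnreal_ennreal).symm

theorem measurable_expInvGivenPath (n t : ℕ) : Measurable (expInvGivenPath m r y n t) :=
  measurable_lintegral_family (measurable_retainedLaw n m r y t)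
    (f := fun p => (p.2.1 : ℝ≥0∞)⁻¹) (measurable_fst.comp measurable_snd).coe_nnreal_ennreal.inv

theorem measurable_joint_mul_expInvGivenPath (n t : ℕ) : Measurable fun z =>
    (m.joint y t z : ℝ≥0∞) * expInvGivenPath m r y n t z :=
  (m.measurable_joint y t).coe_nnreal_ennreal.mul (measurable_expInvGivenPath m r y n t)

/-- The conditional density of the past cancels against `p(x_t, y_{1:t})`. Where the latter
vanishes, so does the joint density, for almost every past. -/
theorem implicitDensity_eq (n t : ℕ) {x : State d} (hx : m.marginal y t x ≠ ∞) :
    implicitDensity m r y n t x = ∫⁻ past : Fin t → State d,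
      m.joint y t (Fin.snoc (α := fun _ => State d) past x) *
        expInvGivenPath m r y n t (Fin.snoc (α := fun _ => State d) past x) := by
  have hs : Measurable fun past : Fin t → State d =>
      (Fin.snoc (α := fun _ => State d) past x : Fin (t + 1) → State d) :=
    measurable_snoc.comp measurable_prodMk_left
  have hj : Measurable fun past : Fin t → State d =>
      (m.joint y t (Fin.snoc (α := fun _ => State d) past x) : ℝ≥0∞) :=
    (m.measurable_joint y t).coe_nnreal_ennreal.comp hs
  rw [implicitDensity, expInvGivenState]
  by_cases h0 : m.marginal y t x = 0
  · have h := (lintegral_eq_zero_iff hj).1 h0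
    rw [h0, zero_mul, eq_comm]
    refine (lintegral_eq_zero_iff
      ((measurable_joint_mul_expInvGivenPath m r y n t).comp hs)).2 ?_
    filter_upwards [h] with past hp
    simp only [Function.comp, Pi.zero_apply] at hp ⊢
    rw [hp, zero_mul]
  · rw [← lintegral_const_mul' _ _ hx]
    refine lintegral_congr fun past => ?_
    rw [← mul_assoc, ENNReal.mul_div_cancel h0 hx]

theorem ae_marginal_ne_top {t : ℕ} (hfin : m.likelihood y t ≠ ∞) :
    ∀ᵐ x, m.marginal y t x ≠ ∞ := by
  rw [← m.lintegral_marginal] at hfin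
  exact (ae_lt_top (m.measurable_marginal y t) hfin).mono fun x hx => hx.ne

theorem measurable_output : Measurable fun ω : Run d n => if ω.1 = 0 then 0 else
    ∑ i, (ω.2.normWeight i : ℝ≥0∞) • Measure.dirac (ω.2 i).1 := by
  have hsum : Measurable fun ω : Run d n =>
      ∑ i, (ω.2.normWeight i : ℝ≥0∞) • Measure.dirac (ω.2 i).1 := by
    refine Measure.measurable_of_measurable_coe _ fun S hS => ?_
    simp only [Measure.finsetSum_apply, Measure.smul_apply, Measure.dirac_apply' _ hS, smul_eq_mul]
    exact Finset.measurable_sum _ fun i _ =>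
      ((Cloud.measurable_normWeight i).comp measurable_snd).coe_nnreal_ennreal.mul <|
        (measurable_one.indicator hS).comp <|
          measurable_fst.comp ((measurable_pi_apply i).comp measurable_snd)
  exact Measurable.ite (measurable_fst (measurableSet_singleton 0)) measurable_const hsum

theorem outputLaw_eq_withDensity (hr₀ : ∀ x, m.init x ≠ 0 → r.init x ≠ 0) (n t : ℕ)
    (hr : ∀ s, 1 ≤ s → s ≤ t → ∀ x x',
      m.trans s x x' * m.obs s x' (y s) ≠ 0 → r.step s x (y s) x' ≠ 0)
    (hfin : m.likelihood y t ≠ ∞) :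
    outputLaw m r y n t = volume.withDensity (implicitDensity m r y n t) := by
  ext A hA
  have hind : Measurable (A.indicator (1 : State d → ℝ≥0∞)) := measurable_one.indicator hA
  have hinv : Measurable fun p : Run d n × State d => ((p.1.1 : ℝ≥0∞))⁻¹ * A.indicator 1 p.2 :=
    (measurable_fst.comp measurable_fst).coe_nnreal_ennreal.inv.mul (hind.comp measurable_snd)
  have h := lintegral_smcLaw_select m r y hr₀ t hr hinv fun p c σ x => rfl
  rw [outputLaw, Measure.bind_apply hA measurable_output.aemeasurable]
  calc _ = ∫⁻ ω, ω.1 * ∑ i, (ω.2.normWeight i : ℝ≥0∞) *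
        ((ω.1 : ℝ≥0∞)⁻¹ * A.indicator 1 (ω.2 i).1) ∂smcLaw m r y n t := by
        refine lintegral_congr fun ω => ?_
        by_cases h0 : ω.1 = 0
        · simp [h0]
        · have h1 : (ω.1 : ℝ≥0∞) * (ω.1 : ℝ≥0∞)⁻¹ = 1 :=
            ENNReal.mul_inv_cancel (by exact_mod_cast h0) ENNReal.coe_ne_top
          simp only [h0, if_false, Measure.finsetSum_apply, Measure.smul_apply,
            Measure.dirac_apply' _ hA, smul_eq_mul, Finset.mul_sum]
          refine Finset.sum_congr rfl fun i _ => ?_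
          rw [mul_left_comm, ← mul_assoc (ω.1 : ℝ≥0∞), h1, one_mul]
    _ = ∫⁻ z, A.indicator 1 (z (Fin.last t)) *
          (m.joint y t z * expInvGivenPath m r y n t z) := by
        rw [h]
        refine lintegral_congr fun z => ?_
        have hinv' : Measurable fun ω : Run d n => (ω.1 : ℝ≥0∞)⁻¹ :=
          measurable_fst.coe_nnreal_ennreal.inv
        simp only [lintegral_mul_const _ hinv', expInvGivenPath]
        ring
    _ = ∫⁻ x, A.indicator 1 x * ∫⁻ past : Fin t → State d,
          m.joint y t (Fin.snoc (α := fun _ => State d) past x) *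
            expInvGivenPath m r y n t (Fin.snoc (α := fun _ => State d) past x) := by
        have hF : Measurable fun z : Fin (t + 1) → State d =>
            A.indicator (1 : State d → ℝ≥0∞) (z (Fin.last t)) *
              (m.joint y t z * expInvGivenPath m r y n t z) :=
          (hind.comp (measurable_pi_apply (Fin.last t))).mul
            (measurable_joint_mul_expInvGivenPath m r y n t)
        rw [lintegral_trajectory hF]
        refine lintegral_congr fun x => ?_
        simp only [Fin.snoc_last]
        exact lintegral_const_mul _ ((measurable_joint_mul_expInvGivenPath m r y n t).comp
          (measurable_snoc.comp measurable_prodMk_left))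
    _ = ∫⁻ x, A.indicator 1 x * implicitDensity m r y n t x := by
        refine lintegral_congr_ae ?_
        filter_upwards [ae_marginal_ne_top m y hfin] with x hx
        rw [implicitDensity_eq m r y n t hx]
    _ = _ := by
        rw [withDensity_apply _ hA, ← lintegral_indicator hA]
        refine lintegral_congr fun x => ?_
        by_cases hx : x ∈ A <;> simp [hx]

theorem outputLaw_univ_le (n t : ℕ) : outputLaw m r y n t Set.univ ≤ 1 := by
  rw [outputLaw, Measure.bind_apply MeasurableSet.univ measurable_output.aemeasurable]
  refine (lintegral_mono fun ω => ?_).trans_eq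
    ((lintegral_one (μ := smcLaw m r y n t)).trans measure_univ)
  have h := ω.2.sum_normWeight
  split_ifs
  · simp
  · simp only [Measure.finsetSum_apply, Measure.smul_apply, measure_univ, smul_eq_mul, mul_one]
    exact_mod_cast h.le

end Output

/-! ### Unnormalized particle estimates -/

section Estimates

/-- The particle estimate `p̂(y_{1:s}) ∑ⱼ Wʲ f(xʲ)` of `∫ p(x_s, y_{1:s}) f(x_s) dx_s`. -/
def estimate (f : State d → ℝ≥0∞) (ω : Run d n) : ℝ≥0∞ :=
  ω.1 * ∑ j, (ω.2.normWeight j : ℝ≥0∞) * f (ω.2 j).1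

theorem measurable_estimate {f : State d → ℝ≥0∞} (hf : Measurable f) :
    Measurable (estimate f : Run d n → ℝ≥0∞) :=
  measurable_fst.coe_nnreal_ennreal.mul <| Finset.measurable_sum _ fun i _ =>
    ((Cloud.measurable_normWeight i).comp measurable_snd).coe_nnreal_ennreal.mul <|
      hf.comp <| measurable_fst.comp ((measurable_pi_apply i).comp measurable_snd)

theorem estimate_one (ω : Run d n) : estimate (fun _ => 1) ω = ω.1 := by
  have h : ∑ j, (ω.2.normWeight j : ℝ≥0∞) = 1 := by exact_mod_cast ω.2.sum_normWeight
  simp only [estimate, mul_one, h]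

theorem estimate_run (f : State d → ℝ≥0∞) (p : ℝ≥0) (c : Cloud d n) :
    estimate f ((p * c.meanWeight, c) : Run d n) =
      p * ((n + 1 : ℕ) : ℝ≥0∞)⁻¹ * ∑ j, ((c j).2 : ℝ≥0∞) * f (c j).1 := by
  rw [estimate, ENNReal.coe_mul, mul_assoc, c.meanWeight_mul_sum, mul_assoc]

/-- Freezing one of the `n + 1` particles changes the mean of the estimate by `O(1 / n)`. -/
theorem lintegral_estimate_pinnedPi_le {f : State d → ℝ≥0∞} (hf : Measurable f) (p : ℝ≥0)
    (a : State d × ℝ≥0) (μ : Measure (State d × ℝ≥0)) [IsProbabilityMeasure μ] :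
    ∫⁻ c : Cloud d n, estimate f ((p * c.meanWeight, c) : Run d n) ∂pinnedPi 0 a μ ≤
      ((n + 1 : ℕ) : ℝ≥0∞)⁻¹ * (a.2 * f a.1) * p + p * ∫⁻ b, b.2 * f b.1 ∂μ := by
  have hg : Measurable fun b : State d × ℝ≥0 => (b.2 : ℝ≥0∞) * f b.1 :=
    measurable_snd.coe_nnreal_ennreal.mul (hf.comp measurable_fst)
  have hi : ∀ i, Measurable fun c : Cloud d n => ((c i).2 : ℝ≥0∞) * f (c i).1 := fun i =>
    hg.comp (measurable_pi_apply i)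
  simp_rw [estimate_run]
  rw [lintegral_const_mul _ (Finset.measurable_sum _ fun i _ => hi i),
    lintegral_finsetSum _ fun i _ => hi i]
  simp_rw [lintegral_pinnedPi_eval (0 : Fin (n + 1)) a μ _ hg]
  rw [Fin.sum_univ_succ]
  simp only [if_true, Fin.succ_ne_zero, if_false, Finset.sum_const, Finset.card_univ,
    Fintype.card_fin, nsmul_eq_mul, mul_add]
  refine add_le_add (le_of_eq (by ring)) ?_
  have h : ((n + 1 : ℕ) : ℝ≥0∞)⁻¹ * n ≤ 1 := by
    rw [mul_comm, ← div_eq_mul_inv]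
    exact ENNReal.div_le_of_le_mul (by rw [one_mul]; exact_mod_cast n.le_succ)
  calc _ = p * (((n + 1 : ℕ) : ℝ≥0∞)⁻¹ * n) * ∫⁻ b, b.2 * f b.1 ∂μ := by ring
    _ ≤ p * 1 * ∫⁻ b, b.2 * f b.1 ∂μ := by gcongr
    _ = _ := by rw [mul_one]

variable (m : Model d Y ν) (r : Proposal d Y) (y : ℕ → Y)

/-- The function `x ↦ ∫ p(x_s = x' | x_{s-1} = x) p(y_s | x_s = x') f(x') dx'`. -/
def Model.propagate (s : ℕ) (f : State d → ℝ≥0∞) (x : State d) : ℝ≥0∞ :=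
  ∫⁻ x', m.step y s x x' * f x'

theorem Model.measurable_propagate (s : ℕ) {f : State d → ℝ≥0∞} (hf : Measurable f) :
    Measurable (m.propagate y s f) :=
  ((m.measurable_step y s).coe_nnreal_ennreal.mul (hf.comp measurable_snd)).lintegral_prod_right'

/-- The unnormalized filtering expectation `∫ p(x_{0:t}, y_{1:t}) f(x_t) dx_{0:t}`. -/
def Model.filterIntegral (t : ℕ) (f : State d → ℝ≥0∞) : ℝ≥0∞ :=
  ∫⁻ z, m.joint y t z * f (z (Fin.last t))

theorem Model.filterIntegral_zero {f : State d → ℝ≥0∞} (hf : Measurable f) :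
    m.filterIntegral y 0 f = ∫⁻ x, m.init x * f x := by
  refine Eq.trans ?_ (lintegral_trajectory_zero (m.measurable_init.coe_nnreal_ennreal.mul hf))
  exact lintegral_congr fun z => by rw [m.joint_zero]; rfl

theorem Model.filterIntegral_succ (s : ℕ) {f : State d → ℝ≥0∞} (hf : Measurable f) :
    m.filterIntegral y (s + 1) f = m.filterIntegral y s (m.propagate y (s + 1) f) := by
  refine (m.lintegral_joint_succ y s
    (hf.comp (measurable_pi_apply (Fin.last (s + 1))))).trans (lintegral_congr fun z => ?_)
  simp only [Function.comp, Fin.snoc_last, propagate]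

theorem Model.filterIntegral_one (t : ℕ) :
    m.filterIntegral y t (fun _ => 1) = m.likelihood y t := by
  simp only [filterIntegral, mul_one, likelihood]

theorem lintegral_weight_mul_particleStep {s : ℕ}
    (hr : ∀ x x', m.trans s x x' * m.obs s x' (y s) ≠ 0 → r.step s x (y s) x' ≠ 0)
    {f : State d → ℝ≥0∞} (hf : Measurable f) (ω : Run d n) :
    ω.1 * ∫⁻ b, b.2 * f b.1 ∂particleStep m r y s ω.2 = estimate (m.propagate y s f) ω := by
  rw [lintegral_weighted_particleStep m r y hr ω.2 (f := fun b => f b.1) (hf.comp measurable_fst)]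
  rfl

theorem ae_ne_top_of_filterIntegral (t : ℕ) {f : State d → ℝ≥0∞} (hf : Measurable f)
    (hfin : m.filterIntegral y t f ≠ ∞) :
    ∀ᵐ z, m.joint y t z ≠ 0 → f (z (Fin.last t)) ≠ ∞ := by
  have hm : Measurable fun z : Fin (t + 1) → State d =>
      (m.joint y t z : ℝ≥0∞) * f (z (Fin.last t)) :=
    (m.measurable_joint y t).coe_nnreal_ennreal.mul (hf.comp (measurable_pi_apply _))
  filter_upwards [ae_lt_top hm hfin] with z hz h0 hf0
  rw [hf0, ENNReal.mul_top (by exact_mod_cast h0)] at hz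
  exact lt_irrefl _ hz

/-- Along almost every retained trajectory of positive density, the mean of the estimate exceeds
the value to be estimated by at most `O(1 / n)`. No moment beyond the first is needed, since the
retained particle contributes linearly. -/
theorem lintegral_estimate_retainedLaw_le (hr₀ : ∀ x, m.init x ≠ 0 → r.init x ≠ 0) (t : ℕ)
    (hr : ∀ s, 1 ≤ s → s ≤ t → ∀ x x',
      m.trans s x x' * m.obs s x' (y s) ≠ 0 → r.step s x (y s) x' ≠ 0)
    (hfin : ∀ s ≤ t, m.likelihood y s ≠ ∞) {f : State d → ℝ≥0∞} (hf : Measurable f)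
    (hΓ : m.filterIntegral y t f ≠ ∞) :
    ∀ᵐ z, m.joint y t z ≠ 0 → ∃ C : ℝ≥0, ∀ n, ∫⁻ ω, estimate f ω ∂retainedLaw m r y n t z ≤
      m.filterIntegral y t f + ((n + 1 : ℕ) : ℝ≥0∞)⁻¹ * C := by
  induction t generalizing f with
  | zero =>
    filter_upwards [ae_ne_top_of_filterIntegral m y 0 hf hΓ] with z hz h0
    refine ⟨((weightInit m r (z 0) : ℝ≥0∞) * f (z 0)).toNNReal, fun n => ?_⟩
    rw [lintegral_retainedLaw_zero n m r y (measurable_estimate hf),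
      ENNReal.coe_toNNReal (ENNReal.mul_ne_top ENNReal.coe_ne_top (b := f (z 0)) (hz h0))]
    have h := lintegral_estimate_pinnedPi_le (n := n) hf 1 (z 0, weightInit m r (z 0))
      (particleInit m r)
    rw [lintegral_weighted_particleInit m r hr₀ (f := fun b => f b.1) (hf.comp measurable_fst)] at h
    simp only [one_mul, ENNReal.coe_one, mul_one] at h
    rw [m.filterIntegral_zero y hf]
    exact h.trans_eq (add_comm _ _)
  | succ s ih =>
    have hr' := fun k hk (hks : k ≤ s) => hr k hk (hks.trans s.le_succ)
    have hfin' := fun k (hks : k ≤ s) => hfin k (hks.trans s.le_succ)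
    have h1 : m.filterIntegral y s (fun _ => 1) ≠ ∞ := by
      rw [m.filterIntegral_one]; exact hfin' s le_rfl
    have hQ : m.filterIntegral y s (m.propagate y (s + 1) f) ≠ ∞ := by
      rwa [← m.filterIntegral_succ y s hf]
    filter_upwards [ae_ne_top_of_filterIntegral m y (s + 1) hf hΓ,
      ae_finInit (ih hr' hfin' measurable_const h1),
      ae_finInit (ih hr' hfin' (m.measurable_propagate y (s + 1) hf) hQ)] with z hz hz1 hzQ h0
    have h0' : m.joint y s (Fin.init z) ≠ 0 := by
      rw [m.joint_succ] at h0
      exact left_ne_zero_of_mul h0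
    obtain ⟨C₁, hC₁⟩ := hz1 h0'
    obtain ⟨C₂, hC₂⟩ := hzQ h0'
    set a := lastParticle m r y s z with ha
    have haf : (a.2 : ℝ≥0∞) * f a.1 ≠ ∞ := ENNReal.mul_ne_top ENNReal.coe_ne_top (hz h0)
    refine ⟨((a.2 : ℝ≥0∞) * f a.1).toNNReal *
      ((m.filterIntegral y s (fun _ => 1)).toNNReal + C₁) + C₂, fun n => ?_⟩
    have hN : ((n + 1 : ℕ) : ℝ≥0∞)⁻¹ ≤ 1 := ENNReal.inv_le_one.2 (by simp)
    rw [lintegral_retainedLaw_succ n m r y (measurable_estimate hf), ← ha,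
      m.filterIntegral_succ y s hf]
    calc _ ≤ ∫⁻ ω, (((n + 1 : ℕ) : ℝ≥0∞)⁻¹ * (a.2 * f a.1) * ω.1 +
            estimate (m.propagate y (s + 1) f) ω) ∂retainedLaw m r y n s (Fin.init z) := by
          refine lintegral_mono fun ω => ?_
          rw [← lintegral_weight_mul_particleStep m r y (hr (s + 1) (by simp) le_rfl) hf]
          exact lintegral_estimate_pinnedPi_le hf ω.1 a _
      _ = ((n + 1 : ℕ) : ℝ≥0∞)⁻¹ * (a.2 * f a.1) *
            (∫⁻ ω, estimate (fun _ => 1) ω ∂retainedLaw m r y n s (Fin.init z)) +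
            ∫⁻ ω, estimate (m.propagate y (s + 1) f) ω ∂retainedLaw m r y n s (Fin.init z) := by
          rw [lintegral_add_right _ (measurable_estimate (m.measurable_propagate y _ hf)),
            lintegral_const_mul _ measurable_fst.coe_nnreal_ennreal]
          simp only [estimate_one]
      _ ≤ ((n + 1 : ℕ) : ℝ≥0∞)⁻¹ * (a.2 * f a.1) *
            (m.filterIntegral y s (fun _ => 1) + 1 * C₁) +
            (m.filterIntegral y s (m.propagate y (s + 1) f) + ((n + 1 : ℕ) : ℝ≥0∞)⁻¹ * C₂) := by
          gcongr
          · exact (hC₁ n).trans (by gcongr)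
          · exact hC₂ n
      _ = _ := by
          simp only [ENNReal.coe_add, ENNReal.coe_mul, ENNReal.coe_toNNReal haf,
            ENNReal.coe_toNNReal h1, one_mul]
          ring

end Estimates

/-! ### Convergence in total variation -/

section TotalVariation

/-- The tangent line bound `1 / p ≥ 2 / L - p / L²`. -/
theorem two_mul_inv_le {L : ℝ≥0} (hL : L ≠ 0) (p : ℝ≥0) :
    2 * (L : ℝ≥0∞)⁻¹ ≤ (p : ℝ≥0∞)⁻¹ + (L : ℝ≥0∞)⁻¹ ^ 2 * p := by
  by_cases hp : p = 0
  · simp [hp]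
  · rw [← ENNReal.coe_inv hL, ← ENNReal.coe_inv hp]
    norm_cast
    have hL' : (0 : ℝ) < L := by positivity
    have hp' : (0 : ℝ) < p := by positivity
    rw [← NNReal.coe_le_coe]
    push_cast
    have h : (p : ℝ)⁻¹ + (L : ℝ)⁻¹ ^ 2 * p - 2 * (L : ℝ)⁻¹ = (p : ℝ)⁻¹ * (1 - (L : ℝ)⁻¹ * p) ^ 2 := by
      field_simp
      ring
    have h2 : 0 ≤ (p : ℝ)⁻¹ * (1 - (L : ℝ)⁻¹ * p) ^ 2 := by positivity
    linarith

variable (m : Model d Y ν) (r : Proposal d Y) (y : ℕ → Y)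

theorem inv_sub_expInvGivenPath_le (n t : ℕ) (z : Fin (t + 1) → State d) {L : ℝ≥0} (hL : L ≠ 0)
    {ε : ℝ≥0∞} (h : ∫⁻ ω, ω.1 ∂retainedLaw m r y n t z ≤ L + ε) :
    (L : ℝ≥0∞)⁻¹ - expInvGivenPath m r y n t z ≤ (L : ℝ≥0∞)⁻¹ ^ 2 * ε := by
  have hL' : (L : ℝ≥0∞) ≠ 0 := by exact_mod_cast hL
  have hm : Measurable fun ω : Run d n => (ω.1 : ℝ≥0∞) := measurable_fst.coe_nnreal_ennreal
  have h1 : 2 * (L : ℝ≥0∞)⁻¹ ≤ expInvGivenPath m r y n t z +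
      (L : ℝ≥0∞)⁻¹ ^ 2 * ∫⁻ ω, ω.1 ∂retainedLaw m r y n t z := by
    have hinv : Measurable fun ω : Run d n => (ω.1 : ℝ≥0∞)⁻¹ := hm.inv
    rw [expInvGivenPath, ← lintegral_const_mul _ hm, ← lintegral_add_left hinv]
    calc 2 * (L : ℝ≥0∞)⁻¹ = ∫⁻ _, 2 * (L : ℝ≥0∞)⁻¹ ∂retainedLaw m r y n t z := by simp
      _ ≤ _ := lintegral_mono fun ω => two_mul_inv_le hL ω.1
  have h2 : (L : ℝ≥0∞)⁻¹ + (L : ℝ≥0∞)⁻¹ ≤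
      (expInvGivenPath m r y n t z + (L : ℝ≥0∞)⁻¹ ^ 2 * ε) + (L : ℝ≥0∞)⁻¹ := by
    calc _ = 2 * (L : ℝ≥0∞)⁻¹ := (two_mul _).symm
      _ ≤ _ := h1
      _ ≤ expInvGivenPath m r y n t z + (L : ℝ≥0∞)⁻¹ ^ 2 * (L + ε) := by gcongr
      _ = _ := by
        rw [mul_add, pow_two, mul_assoc (L : ℝ≥0∞)⁻¹ _ (L : ℝ≥0∞),
          ENNReal.inv_mul_cancel hL' ENNReal.coe_ne_top]
        ring
  rw [tsub_le_iff_left]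
  exact (ENNReal.add_le_add_iff_right (ENNReal.inv_ne_top.2 hL')).1 h2

theorem tendsto_inv_natCast_mul (C : ℝ≥0) :
    Tendsto (fun n : ℕ => ((n + 1 : ℕ) : ℝ≥0∞)⁻¹ * C) atTop (𝓝 0) := by
  have h := ENNReal.Tendsto.mul_const
    (ENNReal.tendsto_inv_nat_nhds_zero.comp (tendsto_add_atTop_nat 1))
    (b := (C : ℝ≥0∞)) (Or.inr ENNReal.coe_ne_top)
  rwa [zero_mul] at h

/-- The shortfall of `q̃` below the posterior vanishes in the limit. Given `x_t`, it is at most the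
integral over the past of the shortfalls of `E[1 / p̂(y_{1:t})]` below `1 / p(y_{1:t})`, which are
dominated by the latter. -/
theorem ae_tendsto_posterior_sub (hr₀ : ∀ x, m.init x ≠ 0 → r.init x ≠ 0) (t : ℕ)
    (hr : ∀ s, 1 ≤ s → s ≤ t → ∀ x x',
      m.trans s x x' * m.obs s x' (y s) ≠ 0 → r.step s x (y s) x' ≠ 0)
    (hpos : m.likelihood y t ≠ 0) (hfin : ∀ s ≤ t, m.likelihood y s ≠ ∞) :
    ∀ᵐ x, Tendsto (fun n => m.posterior y t x - implicitDensity m r y n t x) atTop (𝓝 0) := by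
  have h1 : m.filterIntegral y t (fun _ => 1) ≠ ∞ := by
    rw [m.filterIntegral_one]; exact hfin t le_rfl
  obtain ⟨L, hL⟩ : ∃ L : ℝ≥0, (L : ℝ≥0∞) = m.likelihood y t :=
    ⟨_, ENNReal.coe_toNNReal (hfin t le_rfl)⟩
  have hL0 : L ≠ 0 := by rintro rfl; exact hpos hL.symm
  have hLinv : (L : ℝ≥0∞)⁻¹ ≠ ∞ := ENNReal.inv_ne_top.2 (by exact_mod_cast hL0)
  have hz : ∀ᵐ z, Tendsto (fun n => (m.joint y t z : ℝ≥0∞) *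
      ((L : ℝ≥0∞)⁻¹ - expInvGivenPath m r y n t z)) atTop (𝓝 0) := by
    filter_upwards [lintegral_estimate_retainedLaw_le m r y hr₀ t hr hfin measurable_const h1]
      with z hz
    by_cases h0 : m.joint y t z = 0
    · simp [h0]
    · obtain ⟨C, hC⟩ := hz h0
      simp only [estimate_one, m.filterIntegral_one, ← hL] at hC
      have hlim := ENNReal.Tendsto.const_mul (a := (m.joint y t z : ℝ≥0∞) * (L : ℝ≥0∞)⁻¹ ^ 2)
        (tendsto_inv_natCast_mul C)
        (Or.inr (ENNReal.mul_ne_top ENNReal.coe_ne_top (ENNReal.pow_ne_top hLinv)))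
      rw [mul_zero] at hlim
      refine tendsto_of_tendsto_of_tendsto_of_le_of_le tendsto_const_nhds hlim
        (fun _ => zero_le) fun n => ?_
      dsimp only
      rw [mul_assoc]
      gcongr
      exact inv_sub_expInvGivenPath_le m r y n t z hL0 (hC n)
  filter_upwards [ae_ae_snoc hz, ae_marginal_ne_top m y (hfin t le_rfl)] with x hx hx'
  have hs : Measurable fun past : Fin t → State d =>
      (Fin.snoc (α := fun _ => State d) past x : Fin (t + 1) → State d) :=
    measurable_snoc.comp measurable_prodMk_left
  have hj : Measurable fun past : Fin t → State d =>
      (m.joint y t (Fin.snoc (α := fun _ => State d) past x) : ℝ≥0∞) :=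
    (m.measurable_joint y t).coe_nnreal_ennreal.comp hs
  have hE : ∀ n, Measurable fun past : Fin t → State d =>
      expInvGivenPath m r y n t (Fin.snoc (α := fun _ => State d) past x) := fun n =>
    (measurable_expInvGivenPath m r y n t).comp hs
  have hlim := tendsto_lintegral_of_dominated_convergence
    (fun past : Fin t → State d =>
      (m.joint y t (Fin.snoc (α := fun _ => State d) past x) : ℝ≥0∞) * (L : ℝ≥0∞)⁻¹)
    (fun n => hj.mul (measurable_const.sub (hE n)))
    (fun n => Eventually.of_forall fun past => by dsimp only [Pi.mul_apply]; gcongr; exact tsub_le_self)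
    (by rw [lintegral_mul_const _ hj]; exact ENNReal.mul_ne_top hx' hLinv)
    hx
  rw [lintegral_zero] at hlim
  refine tendsto_of_tendsto_of_tendsto_of_le_of_le tendsto_const_nhds hlim
    (fun _ => zero_le) fun n => ?_
  dsimp only
  have hjL : m.posterior y t x = ∫⁻ past : Fin t → State d,
      (m.joint y t (Fin.snoc (α := fun _ => State d) past x) : ℝ≥0∞) * (L : ℝ≥0∞)⁻¹ := by
    rw [lintegral_mul_const _ hj, Model.posterior, ← hL, div_eq_mul_inv]
    rfl
  rw [implicitDensity_eq m r y n t hx', hjL]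
  refine (lintegral_sub_le _ _ (hj.mul (hE n))).trans (lintegral_mono fun past => ?_)
  dsimp only [Pi.mul_apply, Pi.sub_apply]
  rw [ENNReal.mul_sub fun _ _ => ENNReal.coe_ne_top]

theorem Model.measurable_posterior (t : ℕ) : Measurable (m.posterior y t) :=
  (m.measurable_marginal y t).div_const _

theorem Model.lintegral_posterior {t : ℕ} (hpos : m.likelihood y t ≠ 0)
    (hfin : m.likelihood y t ≠ ∞) : ∫⁻ x, m.posterior y t x = 1 := by
  simp only [posterior, div_eq_mul_inv]
  rw [lintegral_mul_const _ (m.measurable_marginal y t), m.lintegral_marginal,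
    ENNReal.mul_inv_cancel hpos hfin]

theorem measurable_implicitDensity (n t : ℕ) : Measurable (implicitDensity m r y n t) := by
  refine (m.measurable_marginal y t).mul ?_
  have h : Measurable fun p : State d × (Fin t → State d) =>
      (m.joint y t (Fin.snoc (α := fun _ => State d) p.2 p.1) / m.marginal y t p.1) *
        expInvGivenPath m r y n t (Fin.snoc (α := fun _ => State d) p.2 p.1) :=
    (((m.measurable_joint y t).coe_nnreal_ennreal.comp measurable_snoc).div
      ((m.measurable_marginal y t).comp measurable_fst)).mul
        ((measurable_expInvGivenPath m r y n t).comp measurable_snoc)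
  exact h.lintegral_prod_right'

/-- If `f` has at most the mass of `g`, the shortfall of `f` below `g` controls its `L¹` distance to
`g`: its excess over `g` cannot be larger. -/
theorem lintegral_sub_add_sub_le {α : Type*} [MeasurableSpace α] {μ : Measure α}
    {f g : α → ℝ≥0∞} (hf : Measurable f) (hg : Measurable g)
    (hle : ∫⁻ a, f a ∂μ ≤ ∫⁻ a, g a ∂μ) (hfin : ∫⁻ a, g a ∂μ ≠ ∞) :
    ∫⁻ a, ((f a - g a) + (g a - f a)) ∂μ ≤ 2 * ∫⁻ a, (g a - f a) ∂μ := by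
  have h : ∫⁻ a, g a ∂μ + ∫⁻ a, (f a - g a) ∂μ ≤ ∫⁻ a, g a ∂μ + ∫⁻ a, (g a - f a) ∂μ := by
    calc _ = ∫⁻ a, (g a + (f a - g a)) ∂μ := (lintegral_add_left hg _).symm
      _ = ∫⁻ a, (f a + (g a - f a)) ∂μ := by
        refine lintegral_congr fun a => ?_
        rw [add_tsub_eq_max, add_tsub_eq_max, max_comm]
      _ = ∫⁻ a, f a ∂μ + ∫⁻ a, (g a - f a) ∂μ := lintegral_add_left hf _
      _ ≤ _ := by gcongr
  have hfg : Measurable fun a => f a - g a := hf.sub hg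
  rw [lintegral_add_left hfg, two_mul]
  exact add_le_add_left ((ENNReal.add_le_add_iff_left hfin).1 h) _

theorem tendsto_lintegral_implicitDensity (hr₀ : ∀ x, m.init x ≠ 0 → r.init x ≠ 0) (t : ℕ)
    (hr : ∀ s, 1 ≤ s → s ≤ t → ∀ x x',
      m.trans s x x' * m.obs s x' (y s) ≠ 0 → r.step s x (y s) x' ≠ 0)
    (hpos : m.likelihood y t ≠ 0) (hfin : ∀ s ≤ t, m.likelihood y s ≠ ∞) :
    Tendsto (fun n => ∫⁻ x, ((implicitDensity m r y n t x - m.posterior y t x) +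
      (m.posterior y t x - implicitDensity m r y n t x))) atTop (𝓝 0) := by
  have hpost := m.measurable_posterior y t
  have h1 := m.lintegral_posterior y hpos (hfin t le_rfl)
  have hlim := tendsto_lintegral_of_dominated_convergence (m.posterior y t)
    (fun n => hpost.sub (measurable_implicitDensity m r y n t))
    (fun n => Eventually.of_forall fun x => tsub_le_self) (by rw [h1]; exact ENNReal.one_ne_top)
    (ae_tendsto_posterior_sub m r y hr₀ t hr hpos hfin)
  have hlim2 := ENNReal.Tendsto.const_mul (a := 2) hlim (Or.inr ENNReal.ofNat_ne_top)
  rw [lintegral_zero, mul_zero] at hlim2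
  refine tendsto_of_tendsto_of_tendsto_of_le_of_le tendsto_const_nhds hlim2
    (fun _ => zero_le) fun n => ?_
  refine lintegral_sub_add_sub_le (measurable_implicitDensity m r y n t) hpost ?_ ?_
  · rw [h1, ← setLIntegral_univ, ← withDensity_apply _ MeasurableSet.univ,
      ← outputLaw_eq_withDensity m r y hr₀ n t hr (hfin t le_rfl)]
    exact outputLaw_univ_le m r y n t
  · rw [h1]; exact ENNReal.one_ne_top

end TotalVariation

/-! ### Exponential moments of nonnegative random variables -/

section ExpNeg

/-- `exp (-u)`, as a function of extended nonnegative numbers. It is used at finite `u` only; the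
value at `∞` is `1`. -/
def expNeg (u : ℝ≥0∞) : ℝ≥0∞ :=
  ENNReal.ofReal (Real.exp (-u.toReal))

theorem measurable_expNeg : Measurable expNeg :=
  (Real.measurable_exp.comp ENNReal.measurable_toReal.neg).ennreal_ofReal

theorem expNeg_le_one (u : ℝ≥0∞) : expNeg u ≤ 1 := by
  rw [expNeg, ENNReal.ofReal_le_one, Real.exp_le_one_iff]
  simp

theorem expNeg_sum {ι : Type*} (s : Finset ι) {u : ι → ℝ≥0∞} (hu : ∀ i ∈ s, u i ≠ ∞) :
    expNeg (∑ i ∈ s, u i) = ∏ i ∈ s, expNeg (u i) := by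
  simp only [expNeg]
  rw [ENNReal.toReal_sum hu, ← Finset.sum_neg_distrib, Real.exp_sum,
    ENNReal.ofReal_prod_of_nonneg fun _ _ => (Real.exp_pos _).le]

theorem expNeg_add_self_le {u : ℝ≥0∞} {C : ℝ≥0} (hu : u ≤ C) : expNeg u + u ≤ 1 + C ^ 2 := by
  lift u to ℝ≥0 using ne_top_of_le_ne_top ENNReal.coe_ne_top hu
  have hu' : (u : ℝ) ≤ C := by exact_mod_cast hu
  -- `exp (-u) ≤ 1 / (1 + u) ≤ 1 - u + u ^ 2`
  have h : Real.exp (-u) + u ≤ 1 + (C : ℝ) ^ 2 := by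
    have h1 : (1 + (u : ℝ)) * Real.exp (-u) ≤ 1 := by
      calc _ ≤ Real.exp u * Real.exp (-u) := by
            gcongr
            linarith [Real.add_one_le_exp (u : ℝ)]
        _ = 1 := by rw [← Real.exp_add, add_neg_cancel, Real.exp_zero]
    have h2 : Real.exp (-u) ≤ 1 - u + (u : ℝ) ^ 2 := by
      refine le_of_mul_le_mul_left (h1.trans ?_) (by positivity : 0 < 1 + (u : ℝ))
      have : 0 ≤ (u : ℝ) ^ 3 := by positivity
      nlinarith
    have h3 : (u : ℝ) ^ 2 ≤ (C : ℝ) ^ 2 := by gcongr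
    linarith
  have h4 := ENNReal.ofReal_le_ofReal h
  rw [ENNReal.ofReal_add (Real.exp_pos _).le u.coe_nonneg, ENNReal.ofReal_add zero_le_one
    (by positivity), ENNReal.ofReal_pow C.coe_nonneg, ENNReal.ofReal_one, ENNReal.ofReal_coe_nnreal,
    ENNReal.ofReal_coe_nnreal] at h4
  exact h4

theorem lintegral_expNeg_le {α : Type*} [MeasurableSpace α] (μ : Measure α)
    [IsProbabilityMeasure μ] {X : α → ℝ≥0∞} (hX : Measurable X) {C : ℝ≥0}
    (hC : ∀ᵐ a ∂μ, X a ≤ C) : ∫⁻ a, expNeg (X a) ∂μ ≤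
      ENNReal.ofReal (Real.exp (-(∫⁻ a, X a ∂μ).toReal + (C : ℝ) ^ 2)) := by
  have hE : ∫⁻ a, expNeg (X a) ∂μ ≠ ∞ :=
    ne_top_of_le_ne_top ENNReal.one_ne_top <|
      (lintegral_mono fun a => expNeg_le_one (X a)).trans_eq (by simp)
  have hI : ∫⁻ a, X a ∂μ ≠ ∞ :=
    ne_top_of_le_ne_top ENNReal.coe_ne_top ((lintegral_mono_ae hC).trans_eq (by simp : _ = (C : ℝ≥0∞)))
  have h : ∫⁻ a, expNeg (X a) ∂μ + ∫⁻ a, X a ∂μ ≤ 1 + C ^ 2 := by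
    rw [← lintegral_add_right _ hX]
    calc _ ≤ ∫⁻ _, (1 + (C : ℝ≥0∞) ^ 2) ∂μ :=
          lintegral_mono_ae (hC.mono fun a ha => expNeg_add_self_le ha)
      _ = _ := by simp
  have h2 := ENNReal.toReal_mono (by finiteness) h
  rw [ENNReal.toReal_add hE hI, ENNReal.toReal_add ENNReal.one_ne_top (by finiteness)] at h2
  simp only [ENNReal.toReal_one, ENNReal.toReal_pow, ENNReal.coe_toReal] at h2
  rw [← ENNReal.ofReal_toReal hE]
  refine ENNReal.ofReal_le_ofReal (le_trans ?_ (Real.add_one_le_exp _))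
  linarith

end ExpNeg

/-! ### Lower deviations of the estimate for bounded weights -/

section BoundedWeights

theorem Cloud.ae_meanWeight_le {a : State d × ℝ≥0} {μ : Measure (State d × ℝ≥0)}
    [IsProbabilityMeasure μ] {M : ℝ≥0} (ha : a.2 ≤ M) (hμ : ∀ᵐ b ∂μ, b.2 ≤ M) :
    ∀ᵐ c : Cloud d n ∂pinnedPi 0 a μ, c.meanWeight ≤ M := by
  have h : ∀ i : Fin (n + 1), ∀ᵐ c : Cloud d n ∂pinnedPi 0 a μ, (c i).2 ≤ M := fun i => by
    by_cases hi : i = 0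
    · rw [hi]
      exact (ae_pinnedPi_eq 0 a μ).mono fun c hc => by rwa [hc]
    · exact ae_pinnedPi_of_ne (p := fun b => b.2 ≤ M) 0 a hi hμ
  filter_upwards [ae_all_iff.2 h] with c hc
  rw [Cloud.meanWeight, div_le_iff₀ (by positivity), mul_comm]
  calc ∑ i, (c i).2 ≤ ∑ _i : Fin (n + 1), M := Finset.sum_le_sum fun i _ => hc i
    _ = _ := by simp

theorem Cloud.ae_le_meanWeight (a : State d × ℝ≥0) (μ : Measure (State d × ℝ≥0))
    [IsProbabilityMeasure μ] :
    ∀ᵐ c : Cloud d n ∂pinnedPi 0 a μ, a.2 / (n + 1 : ℕ) ≤ c.meanWeight := by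
  filter_upwards [ae_pinnedPi_eq (0 : Fin (n + 1)) a μ] with c hc
  rw [Cloud.meanWeight, ← hc]
  gcongr
  exact Finset.single_le_sum (f := fun i => (c i).2) (fun _ _ => zero_le) (Finset.mem_univ 0)

/-- Conditionally on the past of the run, the estimate has `n` independent bounded terms, besides
the nonnegative term of the frozen particle. -/
theorem lintegral_expNeg_pinnedPi_le {f : State d → ℝ≥0∞} (hf : Measurable f) {B M P : ℝ≥0}
    (hB : ∀ x, f x ≤ B) (a : State d × ℝ≥0) {μ : Measure (State d × ℝ≥0)} [IsProbabilityMeasure μ]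
    (hμ : ∀ᵐ b ∂μ, b.2 ≤ M) {p : ℝ≥0} (hp : p ≤ P) (l : ℝ≥0) :
    ∫⁻ c : Cloud d n, expNeg (l * estimate f ((p * c.meanWeight, c) : Run d n)) ∂pinnedPi 0 a μ ≤
      expNeg ((l * (n / (n + 1 : ℕ)) : ℝ≥0) * (p * ∫⁻ b, b.2 * f b.1 ∂μ)) *
        ENNReal.ofReal (Real.exp ((P * M * B) ^ 2 * l ^ 2 / (n + 1 : ℕ))) := by
  set κ : ℝ≥0 := l * p / (n + 1 : ℕ) with hκ
  have hg : Measurable fun b : State d × ℝ≥0 => (b.2 : ℝ≥0∞) * f b.1 :=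
    measurable_snd.coe_nnreal_ennreal.mul (hf.comp measurable_fst)
  have hκg : Measurable fun b : State d × ℝ≥0 => (κ : ℝ≥0∞) * ((b.2 : ℝ≥0∞) * f b.1) :=
    hg.const_mul _
  have hgB : ∀ᵐ b ∂μ, (κ : ℝ≥0∞) * (b.2 * f b.1) ≤ (κ * (M * B) : ℝ≥0) := by
    filter_upwards [hμ] with b hb
    push_cast
    gcongr
    exact hB b.1
  have hprod : ∀ c : Cloud d n, expNeg (l * estimate f ((p * c.meanWeight, c) : Run d n)) =
      ∏ i, expNeg (κ * ((c i).2 * f (c i).1)) := fun c => by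
    rw [estimate_run, ← expNeg_sum _ fun i _ => ENNReal.mul_ne_top ENNReal.coe_ne_top
      (ENNReal.mul_ne_top ENNReal.coe_ne_top (ne_top_of_le_ne_top ENNReal.coe_ne_top (hB _))),
      ← Finset.mul_sum, hκ, ENNReal.coe_div (by positivity), ENNReal.div_eq_inv_mul,
      ENNReal.coe_natCast, ENNReal.coe_mul]
    congr 1
    ring
  simp_rw [hprod]
  rw [pinnedPi, lintegral_pi_prod (α := State d × ℝ≥0)
    (f := fun _ b => expNeg (κ * (b.2 * f b.1)))
    fun _ => measurable_expNeg.comp hκg, Fin.prod_univ_succ]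
  simp only [if_true, Fin.succ_ne_zero, if_false, Finset.prod_const, Finset.card_univ,
    Fintype.card_fin]
  have h0 : ∫⁻ b, expNeg (κ * (b.2 * f b.1)) ∂(Measure.dirac a) ≤ 1 :=
    (lintegral_mono fun b => expNeg_le_one _).trans_eq (by simp)
  refine (mul_le_mul' h0 (pow_le_pow_left' (lintegral_expNeg_le μ hκg hgB) n)).trans ?_
  rw [one_mul, expNeg, ← ENNReal.ofReal_pow (Real.exp_pos _).le, ← Real.exp_nat_mul,
    ← ENNReal.ofReal_mul (Real.exp_pos _).le, ← Real.exp_add]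
  refine ENNReal.ofReal_le_ofReal (Real.exp_le_exp.2 ?_)
  rw [mul_add]
  refine add_le_add (le_of_eq ?_) ?_
  · rw [lintegral_const_mul _ hg]
    simp only [ENNReal.toReal_mul, ENNReal.coe_toReal, hκ]
    push_cast
    ring
  · have hN : (0 : ℝ) < (n + 1 : ℕ) := by positivity
    have hp' : (p : ℝ) ≤ P := by exact_mod_cast hp
    have h1 : ((κ * (M * B) : ℝ≥0) : ℝ) ^ 2 =
        (p * M * B) ^ 2 * l ^ 2 / (n + 1 : ℕ) / (n + 1 : ℕ) := by
      rw [hκ]; push_cast; field_simp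
    have h2 : (n : ℝ) ≤ (n + 1 : ℕ) := by push_cast; linarith
    rw [h1]
    calc (n : ℝ) * ((p * M * B : ℝ) ^ 2 * l ^ 2 / (n + 1 : ℕ) / (n + 1 : ℕ))
        ≤ ((n + 1 : ℕ) : ℝ) * ((p * M * B : ℝ) ^ 2 * l ^ 2 / (n + 1 : ℕ) / (n + 1 : ℕ)) := by
          gcongr
      _ = (p * M * B : ℝ) ^ 2 * l ^ 2 / (n + 1 : ℕ) := by field_simp
      _ ≤ _ := by gcongr

variable (m : Model d Y ν) (r : Proposal d Y) (y : ℕ → Y)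

theorem ae_particleInit_weight_le {M : ℝ≥0} (hM₀ : ∀ x, weightInit m r x ≤ M) :
    ∀ᵐ b ∂particleInit m r, b.2 ≤ M := by
  have hS : MeasurableSet {b : State d × ℝ≥0 | ¬ b.2 ≤ M} :=
    (measurableSet_le measurable_snd measurable_const).compl
  rw [ae_iff, ← lintegral_indicator_one hS, lintegral_particleInit m r (measurable_one.indicator hS)]
  simp [hM₀]

theorem ae_particleStep_weight_le {M : ℝ≥0} {s : ℕ} (hM : ∀ x x', weight m r y s x x' ≤ M)
    (c : Cloud d n) : ∀ᵐ b ∂particleStep m r y s c, b.2 ≤ M := by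
  have hS : MeasurableSet {b : State d × ℝ≥0 | ¬ b.2 ≤ M} :=
    (measurableSet_le measurable_snd measurable_const).compl
  rw [ae_iff, ← lintegral_indicator_one hS,
    lintegral_particleStep m r y s c (measurable_one.indicator hS)]
  simp [hM]

/-- The product of the weights along a trajectory. -/
def pathWeight : (s : ℕ) → (Fin (s + 1) → State d) → ℝ≥0
  | 0, z => weightInit m r (z 0)
  | s + 1, z => pathWeight s (Fin.init z) * (lastParticle m r y s z).2

/-- The proposal density `r₀(x₀) ∏ r_k(x_k | x_{k-1}, y_k)` of a trajectory. -/
def pathDensity : (s : ℕ) → (Fin (s + 1) → State d) → ℝ≥0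
  | 0, z => r.init (z 0)
  | s + 1, z => pathDensity s (Fin.init z) *
      r.step (s + 1) (z (Fin.last s).castSucc) (y (s + 1)) (z (Fin.last (s + 1)))

theorem joint_eq_pathDensity_mul_pathWeight (hr₀ : ∀ x, m.init x ≠ 0 → r.init x ≠ 0) (t : ℕ)
    (hr : ∀ s, 1 ≤ s → s ≤ t → ∀ x x',
      m.trans s x x' * m.obs s x' (y s) ≠ 0 → r.step s x (y s) x' ≠ 0)
    (z : Fin (t + 1) → State d) :
    m.joint y t z = pathDensity r y t z * pathWeight m r y t z := by
  induction t with
  | zero => rw [m.joint_zero, pathDensity, pathWeight, proposal_mul_weightInit m r hr₀]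
  | succ s ih =>
    rw [m.joint_succ, pathDensity, pathWeight,
      ih (fun k hk hks => hr k hk (hks.trans s.le_succ)), lastParticle,
      ← proposal_mul_weight m r y (hr (s + 1) (by simp) le_rfl)]
    ring

theorem measurable_pathDensity {Y : Type*} (r : Proposal d Y) (y : ℕ → Y) (t : ℕ) : Measurable (pathDensity r y t) := by
  induction t with
  | zero => exact r.measurable_init.comp (measurable_pi_apply 0)
  | succ s ih =>
    have h : Measurable fun z : Fin (s + 2) → State d =>
        (z (Fin.last s).castSucc, z (Fin.last (s + 1))) :=
      (measurable_pi_apply _).prodMk (measurable_pi_apply _)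
    exact (ih.comp measurable_finInit).mul ((r.measurable_step (s + 1) (y (s + 1))).comp h)

theorem lintegral_pathDensity {Y : Type*} (r : Proposal d Y) (y : ℕ → Y) (t : ℕ) :
    ∫⁻ z, pathDensity r y t z = 1 := by
  induction t with
  | zero =>
    exact (lintegral_trajectory_zero r.measurable_init.coe_nnreal_ennreal).trans r.lintegral_init
  | succ s ih =>
    rw [lintegral_trajectory' (measurable_pathDensity r y (s + 1)).coe_nnreal_ennreal, ← ih]
    refine lintegral_congr fun z => ?_
    simp only [pathDensity, Fin.init_snoc, Fin.snoc_last, Fin.snoc_castSucc, ENNReal.coe_mul]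
    rw [lintegral_const_mul' _ _ ENNReal.coe_ne_top, r.lintegral_step, mul_one]

theorem propagate_le {s : ℕ}
    (hr : ∀ x x', m.trans s x x' * m.obs s x' (y s) ≠ 0 → r.step s x (y s) x' ≠ 0) {M B : ℝ≥0}
    (hM : ∀ x x', weight m r y s x x' ≤ M) {f : State d → ℝ≥0∞} (hB : ∀ x, f x ≤ B)
    (x : State d) : m.propagate y s f x ≤ (M * B : ℝ≥0) := by
  calc _ ≤ ∫⁻ x', r.step s x (y s) x' * ((M * B : ℝ≥0) : ℝ≥0∞) := by
        refine lintegral_mono fun x' => ?_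
        rw [← proposal_mul_weight m r y hr, ENNReal.coe_mul, ENNReal.coe_mul, mul_assoc]
        gcongr
        · exact hM x x'
        · exact hB x'
    _ = _ := by rw [lintegral_mul_const' _ _ ENNReal.coe_ne_top, r.lintegral_step, one_mul]

variable {t : ℕ} {M : ℝ≥0}

/-- The estimate is bounded above if the weights are, and it is bounded below since the mean weight at
each time is at least the share of the retained particle. -/
theorem ae_retainedLaw_bounds (hM₀ : ∀ x, weightInit m r x ≤ M)
    (hM : ∀ s, 1 ≤ s → s ≤ t → ∀ x x', weight m r y s x x' ≤ M) (z : Fin (t + 1) → State d) :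
    ∀ᵐ ω ∂retainedLaw m r y n t z, ω.1 ≤ M ^ (t + 1) ∧
      pathWeight m r y t z / (n + 1 : ℕ) ^ (t + 1) ≤ ω.1 := by
  have hmeas : ∀ u v : ℝ≥0, MeasurableSet {ω : Run d n | ω.1 ≤ u ∧ v ≤ ω.1} := fun u v =>
    have h : Measurable fun ω : Run d n => ω.1 := measurable_fst
    have hu : MeasurableSet {ω : Run d n | ω.1 ≤ u} := measurableSet_le h measurable_const
    have hv : MeasurableSet {ω : Run d n | v ≤ ω.1} := measurableSet_le measurable_const h
    hu.inter hv
  induction t with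
  | zero =>
    rw [retainedLaw_zero, ae_map_iff (measurable_initRun n).aemeasurable (hmeas _ _)]
    filter_upwards [Cloud.ae_meanWeight_le (n := n) (a := (z 0, weightInit m r (z 0))) (hM₀ _)
      (ae_particleInit_weight_le m r hM₀),
      Cloud.ae_le_meanWeight (n := n) (z 0, weightInit m r (z 0)) (particleInit m r)] with c h1 h2
    simp only [zero_add, pow_one]
    exact ⟨h1, h2⟩
  | succ s ih =>
    have hMs := hM (s + 1) (by simp) le_rfl
    rw [retainedLaw_succ]
    refine ae_bind_of_ae (measurable_pinnedStep' n m r y _ _) (hmeas _ _) ?_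
    filter_upwards [ih (fun k hk hks => hM k hk (hks.trans s.le_succ)) (Fin.init z)] with ω hω
    have hrun : Measurable fun c : Cloud d n => ((ω.1 * c.meanWeight, c) : Run d n) :=
      measurable_run n measurable_const measurable_id
    rw [pinnedStep, ae_map_iff hrun.aemeasurable (hmeas _ _)]
    filter_upwards [Cloud.ae_meanWeight_le (n := n) (a := lastParticle m r y s z) (hMs _ _)
      (ae_particleStep_weight_le m r y hMs ω.2),
      Cloud.ae_le_meanWeight (n := n) (lastParticle m r y s z)
        (particleStep m r y (s + 1) ω.2)] with c h1 h2
    refine ⟨?_, ?_⟩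
    · rw [pow_succ]
      exact mul_le_mul' hω.1 h1
    · rw [pathWeight, pow_succ, mul_div_mul_comm]
      exact mul_le_mul' hω.2 h2

/-- The lower exponential moments of the estimate are, up to a factor `exp (K l² / (n + 1))`, those
of its limit, uniformly in the retained trajectory. Only a fraction `n / (n + 1)` of the limit is
kept at each time, since the contribution of the frozen particle is dropped. -/
theorem exists_lintegral_expNeg_estimate_le (hr₀ : ∀ x, m.init x ≠ 0 → r.init x ≠ 0)
    (hr : ∀ s, 1 ≤ s → s ≤ t → ∀ x x',
      m.trans s x x' * m.obs s x' (y s) ≠ 0 → r.step s x (y s) x' ≠ 0)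
    (hM₀ : ∀ x, weightInit m r x ≤ M)
    (hM : ∀ s, 1 ≤ s → s ≤ t → ∀ x x', weight m r y s x x' ≤ M) (B : ℝ≥0) :
    ∃ K : ℝ≥0, ∀ f : State d → ℝ≥0∞, Measurable f → (∀ x, f x ≤ B) →
      ∀ n (z : Fin (t + 1) → State d) (l : ℝ≥0),
        ∫⁻ ω, expNeg (l * estimate f ω) ∂retainedLaw m r y n t z ≤
          expNeg ((l * (n / (n + 1 : ℕ)) ^ (t + 1) : ℝ≥0) * m.filterIntegral y t f) *
            ENNReal.ofReal (Real.exp (K * l ^ 2 / (n + 1 : ℕ))) := by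
  have hmeas : ∀ {f : State d → ℝ≥0∞}, Measurable f → ∀ n (l : ℝ≥0),
      Measurable fun ω : Run d n => expNeg (l * estimate f ω) := fun hf n l =>
    measurable_expNeg.comp ((measurable_estimate hf).const_mul _)
  induction t generalizing B with
  | zero =>
    refine ⟨(1 * M * B) ^ 2, fun f hf hB n z l => ?_⟩
    rw [lintegral_retainedLaw_zero n m r y (hmeas hf n l), m.filterIntegral_zero y hf,
      ← lintegral_weighted_particleInit m r hr₀ (f := fun b => f b.1) (hf.comp measurable_fst)]
    have h := lintegral_expNeg_pinnedPi_le (n := n) hf hB (z 0, weightInit m r (z 0))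
      (ae_particleInit_weight_le m r hM₀) (p := 1) le_rfl l
    simp only [one_mul, ENNReal.coe_one, NNReal.coe_one] at h
    simpa only [zero_add, pow_one, one_mul, NNReal.coe_pow, NNReal.coe_mul] using h
  | succ s ih =>
    have hr' := fun k hk (hks : k ≤ s) => hr k hk (hks.trans s.le_succ)
    have hM' := fun k hk (hks : k ≤ s) => hM k hk (hks.trans s.le_succ)
    have hMs := hM (s + 1) (by simp) le_rfl
    have hrs := hr (s + 1) (by simp) le_rfl
    obtain ⟨K, hK⟩ := ih hr' hM' (M * B)
    refine ⟨K + (M ^ (s + 1) * M * B) ^ 2, fun f hf hB n z l => ?_⟩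
    have hQ := m.measurable_propagate y (s + 1) hf
    set l' : ℝ≥0 := l * (n / (n + 1 : ℕ)) with hl'
    have hl : l' ≤ l := by
      refine mul_le_of_le_one_right' (div_le_one_of_le₀ ?_ zero_le)
      exact_mod_cast n.le_succ
    set D := ENNReal.ofReal (Real.exp ((((M ^ (s + 1) : ℝ≥0) : ℝ) * M * B) ^ 2 * l ^ 2 /
      (n + 1 : ℕ))) with hD
    rw [lintegral_retainedLaw_succ n m r y (hmeas hf n l), m.filterIntegral_succ y s hf]
    calc _ ≤ ∫⁻ ω, expNeg (l' * estimate (m.propagate y (s + 1) f) ω) * D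
            ∂retainedLaw m r y n s (Fin.init z) := by
          refine lintegral_mono_ae ?_
          filter_upwards [ae_retainedLaw_bounds m r y hM₀ hM' (Fin.init z)] with ω hω
          rw [← lintegral_weight_mul_particleStep m r y hrs hf]
          exact lintegral_expNeg_pinnedPi_le hf hB _ (ae_particleStep_weight_le m r y hMs ω.2)
            hω.1 l
      _ = (∫⁻ ω, expNeg (l' * estimate (m.propagate y (s + 1) f) ω)
            ∂retainedLaw m r y n s (Fin.init z)) * D := lintegral_mul_const _ (hmeas hQ n l')
      _ ≤ expNeg ((l' * (n / (n + 1 : ℕ)) ^ (s + 1) : ℝ≥0) *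
            m.filterIntegral y s (m.propagate y (s + 1) f)) *
            ENNReal.ofReal (Real.exp (K * l' ^ 2 / (n + 1 : ℕ))) * D := by
          gcongr
          exact hK _ hQ (propagate_le m r y hrs hMs hB) n (Fin.init z) l'
      _ ≤ _ := by
          rw [mul_assoc, hl', mul_assoc l, ← pow_succ', hD, ← ENNReal.ofReal_mul (Real.exp_pos _).le,
            ← Real.exp_add]
          gcongr
          have hl2 : (l' : ℝ) ≤ l := by exact_mod_cast hl
          rw [← hl', ← add_div]
          gcongr
          push_cast
          rw [add_mul]
          gcongr

/-- Either the estimate is at least `a`, or it is still bounded below by the product of the weights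
of the retained trajectory, which costs a power of `n + 1` only. -/
theorem expInvGivenPath_le (hM₀ : ∀ x, weightInit m r x ≤ M)
    (hM : ∀ s, 1 ≤ s → s ≤ t → ∀ x x', weight m r y s x x' ≤ M) (z : Fin (t + 1) → State d)
    (a l : ℝ≥0) :
    expInvGivenPath m r y n t z ≤ (a : ℝ≥0∞)⁻¹ + (n + 1 : ℕ) ^ (t + 1) *
      (pathWeight m r y t z : ℝ≥0∞)⁻¹ * (ENNReal.ofReal (Real.exp (l * a)) *
        ∫⁻ ω, expNeg (l * estimate (fun _ => 1) ω) ∂retainedLaw m r y n t z) := by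
  have hexp : Measurable fun ω : Run d n => expNeg (l * estimate (fun _ => 1) ω) :=
    measurable_expNeg.comp ((measurable_estimate measurable_const).const_mul _)
  rw [← lintegral_const_mul _ hexp, ← lintegral_const_mul _ (hexp.const_mul _), expInvGivenPath]
  calc _ ≤ ∫⁻ ω, ((a : ℝ≥0∞)⁻¹ + (n + 1 : ℕ) ^ (t + 1) * (pathWeight m r y t z : ℝ≥0∞)⁻¹ *
          (ENNReal.ofReal (Real.exp (l * a)) * expNeg (l * estimate (fun _ => 1) ω)))
            ∂retainedLaw m r y n t z := by
        refine lintegral_mono_ae ?_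
        filter_upwards [ae_retainedLaw_bounds m r y hM₀ hM z] with ω hω
        rcases le_total a ω.1 with h | h
        · exact (ENNReal.inv_le_inv.2 (by exact_mod_cast h)).trans le_self_add
        · refine le_trans ?_ le_add_self
          have h1 : (1 : ℝ≥0∞) ≤ ENNReal.ofReal (Real.exp (l * a)) *
              expNeg (l * estimate (fun _ => 1) ω) := by
            rw [estimate_one, expNeg, ← ENNReal.ofReal_mul (Real.exp_pos _).le, ← Real.exp_add,
              ENNReal.one_le_ofReal, Real.one_le_exp_iff, ENNReal.toReal_mul, ENNReal.coe_toReal,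
              ENNReal.coe_toReal]
            have : (l : ℝ) * ω.1 ≤ l * a := by gcongr
            linarith
          have h2 : (ω.1 : ℝ≥0∞)⁻¹ ≤ (n + 1 : ℕ) ^ (t + 1) * (pathWeight m r y t z : ℝ≥0∞)⁻¹ := by
            have hlow : (pathWeight m r y t z : ℝ≥0∞) / (n + 1 : ℕ) ^ (t + 1) ≤ ω.1 := by
              have := ENNReal.coe_le_coe.2 hω.2
              rwa [ENNReal.coe_div (by positivity), ENNReal.coe_pow, ENNReal.coe_natCast] at this
            refine (ENNReal.inv_le_inv.2 hlow).trans_eq ?_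
            rw [ENNReal.inv_div (Or.inl (by finiteness)) (Or.inl (by positivity)), div_eq_mul_inv]
          calc _ ≤ _ := h2
            _ ≤ _ := le_mul_of_one_le_right' h1
    _ = _ := by rw [lintegral_add_left measurable_const]; simp

end BoundedWeights

/-! ### Almost everywhere convergence for bounded weights -/

section AlmostEverywhere

/-- At the rate `l = √N / c`, the exponential bound beats every power of `N = n + 1`. -/
theorem exists_tendsto_pow_mul_exp (k : ℕ) (K : ℝ) {a L : ℝ≥0} (haL : a < L) :
    ∃ l : ℕ → ℝ≥0, Tendsto (fun n : ℕ => ((n + 1 : ℕ) : ℝ≥0∞) ^ k *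
      (ENNReal.ofReal (Real.exp (l n * a)) *
        (expNeg ((l n * (n / (n + 1 : ℕ)) ^ k : ℝ≥0) * L) *
          ENNReal.ofReal (Real.exp (K * l n ^ 2 / (n + 1 : ℕ)))))) atTop (𝓝 0) := by
  have haL' : (a : ℝ) < L := by exact_mod_cast haL
  set c : ℝ≥0 := (L - a) / 2 with hc
  have hcr : (c : ℝ) = (L - a) / 2 := by rw [hc]; push_cast [NNReal.coe_sub haL.le]; rfl
  have hc0 : (0 : ℝ) < c := by rw [hcr]; linarith
  refine ⟨fun n => NNReal.sqrt (n + 1 : ℕ) / c, ?_⟩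
  set u : ℕ → ℝ := fun n => Real.sqrt (n + 1 : ℕ) with hu
  have hu2 : ∀ n, u n ^ 2 = (n + 1 : ℕ) := fun n => Real.sq_sqrt (Nat.cast_nonneg _)
  have hulim : Tendsto u atTop atTop :=
    Real.tendsto_sqrt_atTop.comp (tendsto_natCast_atTop_atTop.comp (tendsto_add_atTop_nat 1))
  have hρ : Tendsto (fun n : ℕ => ((n : ℝ) / (n + 1 : ℕ)) ^ k * L) atTop (𝓝 L) := by
    have h := ((tendsto_natCast_div_add_atTop (1 : ℝ)).pow k).mul_const (L : ℝ)
    rw [one_pow, one_mul] at h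
    simpa only [Nat.cast_add, Nat.cast_one] using h
  have hlim : Tendsto (fun n => ENNReal.ofReal
      (u n ^ (2 * k) * Real.exp (-u n) * Real.exp (K / c ^ 2))) atTop (𝓝 0) := by
    have h := ((Real.tendsto_pow_mul_exp_neg_atTop_nhds_zero (2 * k)).comp hulim).mul_const
      (Real.exp (K / c ^ 2))
    rw [zero_mul] at h
    simpa using ENNReal.tendsto_ofReal h
  refine tendsto_of_tendsto_of_tendsto_of_le_of_le' tendsto_const_nhds hlim
    (Eventually.of_forall fun _ => zero_le) ?_
  filter_upwards [hρ.eventually_const_lt (show (a : ℝ) + c < L by rw [hcr]; linarith)] with n hn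
  have hN : (0 : ℝ) < (n + 1 : ℕ) := by positivity
  rw [expNeg, ← ENNReal.ofReal_mul (Real.exp_pos _).le, ← ENNReal.ofReal_mul (Real.exp_pos _).le,
    ← Real.exp_add, ← Real.exp_add, ← ENNReal.ofReal_natCast, ← ENNReal.ofReal_pow hN.le,
    ← ENNReal.ofReal_mul (by positivity)]
  refine ENNReal.ofReal_le_ofReal ?_
  rw [pow_mul, hu2, mul_assoc, ← Real.exp_add]
  refine mul_le_mul_of_nonneg_left (Real.exp_le_exp.2 ?_) (by positivity)
  simp only [ENNReal.toReal_mul, ENNReal.coe_toReal]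
  have hl : ((NNReal.sqrt (n + 1 : ℕ) / c : ℝ≥0) : ℝ) = u n / c := by
    rw [NNReal.coe_div, Real.coe_sqrt, NNReal.coe_natCast]
  have h1 : K * ((NNReal.sqrt (n + 1 : ℕ) / c : ℝ≥0) : ℝ) ^ 2 / (n + 1 : ℕ) = K / c ^ 2 := by
    rw [hl, div_pow, hu2]
    field_simp
  have h2 : u n / c * (a - ((n : ℝ) / (n + 1 : ℕ)) ^ k * L) ≤ -u n := by
    have hun : 0 ≤ u n / c := by positivity
    calc _ ≤ u n / c * (-c) := by gcongr; linarith
      _ = -u n := by field_simp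
  rw [h1, NNReal.coe_mul, hl]
  push_cast at h2 ⊢
  linarith

variable (m : Model d Y ν) (r : Proposal d Y) (y : ℕ → Y) {t : ℕ} {M : ℝ≥0}

/-- For `a < p(y_{1:t})`, `E[1 / p̂(y_{1:t})]` is at most `1 / a`, up to an error that becomes a small
multiple of the proposal density after multiplication with `p(x_{0:t}, y_{1:t})`. -/
theorem exists_joint_mul_expInvGivenPath_le (hr₀ : ∀ x, m.init x ≠ 0 → r.init x ≠ 0)
    (hr : ∀ s, 1 ≤ s → s ≤ t → ∀ x x',
      m.trans s x x' * m.obs s x' (y s) ≠ 0 → r.step s x (y s) x' ≠ 0)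
    (hM₀ : ∀ x, weightInit m r x ≤ M)
    (hM : ∀ s, 1 ≤ s → s ≤ t → ∀ x x', weight m r y s x x' ≤ M) {a L : ℝ≥0} (haL : a < L)
    (hL : (L : ℝ≥0∞) = m.likelihood y t) :
    ∃ ε : ℕ → ℝ≥0∞, Tendsto ε atTop (𝓝 0) ∧ ∀ n z,
      m.joint y t z * expInvGivenPath m r y n t z ≤
        m.joint y t z * (a : ℝ≥0∞)⁻¹ + ε n * pathDensity r y t z := by
  obtain ⟨K, hK⟩ := exists_lintegral_expNeg_estimate_le m r y hr₀ hr hM₀ hM 1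
  obtain ⟨l, hl⟩ := exists_tendsto_pow_mul_exp (t + 1) K haL
  refine ⟨_, hl, fun n z => ?_⟩
  by_cases h0 : m.joint y t z = 0
  · simp [h0]
  have hj := joint_eq_pathDensity_mul_pathWeight m r y hr₀ t hr z
  have hw : pathWeight m r y t z ≠ 0 := by
    rw [hj] at h0
    exact right_ne_zero_of_mul h0
  have hdiv : (m.joint y t z : ℝ≥0∞) * (pathWeight m r y t z : ℝ≥0∞)⁻¹ = pathDensity r y t z := by
    rw [hj, ENNReal.coe_mul, mul_assoc,
      ENNReal.mul_inv_cancel (by exact_mod_cast hw) ENNReal.coe_ne_top, mul_one]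
  have h := hK (fun _ => 1) measurable_const (fun _ => le_rfl) n z (l n)
  rw [m.filterIntegral_one, ← hL] at h
  calc _ ≤ (m.joint y t z : ℝ≥0∞) * _ :=
        mul_le_mul_right ((expInvGivenPath_le m r y hM₀ hM z a (l n)).trans
          (add_le_add_right (mul_le_mul_right (mul_le_mul_right h _) _) _)) _
    _ = _ := by
        rw [mul_add, ← hdiv]
        ring

theorem ae_tendsto_implicitDensity (hr₀ : ∀ x, m.init x ≠ 0 → r.init x ≠ 0)
    (hr : ∀ s, 1 ≤ s → s ≤ t → ∀ x x',
      m.trans s x x' * m.obs s x' (y s) ≠ 0 → r.step s x (y s) x' ≠ 0)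
    (hpos : m.likelihood y t ≠ 0) (hfin : ∀ s ≤ t, m.likelihood y s ≠ ∞)
    (hM₀ : ∀ x, weightInit m r x ≤ M)
    (hM : ∀ s, 1 ≤ s → s ≤ t → ∀ x x', weight m r y s x x' ≤ M) :
    ∀ᵐ x, Tendsto (fun n => implicitDensity m r y n t x) atTop (𝓝 (m.posterior y t x)) := by
  obtain ⟨L, hL⟩ : ∃ L : ℝ≥0, (L : ℝ≥0∞) = m.likelihood y t :=
    ⟨_, ENNReal.coe_toNNReal (hfin t le_rfl)⟩
  have hL0 : L ≠ 0 := by rintro rfl; exact hpos (by rw [← hL, ENNReal.coe_zero])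
  have hR : ∀ᵐ x, ∫⁻ past : Fin t → State d,
      (pathDensity r y t (Fin.snoc (α := fun _ => State d) past x) : ℝ≥0∞) < ∞ := by
    have hm := (measurable_pathDensity r y t).coe_nnreal_ennreal
    refine ae_lt_top (hm.comp measurable_snoc).lintegral_prod_right' ?_
    have h := lintegral_trajectory hm
    rw [lintegral_pathDensity] at h
    exact h.symm ▸ ENNReal.one_ne_top
  filter_upwards [hR, ae_marginal_ne_top m y (hfin t le_rfl),
    ae_tendsto_posterior_sub m r y hr₀ t hr hpos hfin] with x hRx hx hsub
  have hs : Measurable fun past : Fin t → State d =>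
      (Fin.snoc (α := fun _ => State d) past x : Fin (t + 1) → State d) :=
    measurable_snoc.comp measurable_prodMk_left
  have hj : Measurable fun past : Fin t → State d =>
      (m.joint y t (Fin.snoc (α := fun _ => State d) past x) : ℝ≥0∞) :=
    (m.measurable_joint y t).coe_nnreal_ennreal.comp hs
  rw [tendsto_order]
  constructor
  · intro b hb
    filter_upwards [(tendsto_order.1 hsub).2 _ (tsub_pos_of_lt hb)] with n hn
    by_contra! hle
    exact absurd hn (not_lt.2 (tsub_le_tsub_left hle _))
  · intro b hb
    -- choose `a < L` so close to `L` that `p(x_t, y_{1:t}) / a < b`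
    have hlim : Tendsto (fun a : ℝ≥0 => m.marginal y t x * (a : ℝ≥0∞)⁻¹) (𝓝[<] L)
        (𝓝 (m.posterior y t x)) := by
      rw [Model.posterior, ← hL, div_eq_mul_inv]
      refine ENNReal.Tendsto.const_mul ?_ (Or.inr hx)
      exact (tendsto_inv_iff.2 (ENNReal.tendsto_coe.2 tendsto_id)).mono_left
        nhdsWithin_le_nhds
    have hbot : (𝓝[<] L).NeBot := nhdsLT_neBot_of_exists_lt ⟨0, pos_iff_ne_zero.2 hL0⟩
    obtain ⟨a, hab, haL⟩ := ((hlim.eventually_lt_const hb).and self_mem_nhdsWithin).exists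
    obtain ⟨ε, hε, hle⟩ := exists_joint_mul_expInvGivenPath_le m r y hr₀ hr hM₀ hM haL hL
    set R := ∫⁻ past : Fin t → State d,
      (pathDensity r y t (Fin.snoc (α := fun _ => State d) past x) : ℝ≥0∞)
    have hbound : ∀ n, implicitDensity m r y n t x ≤ m.marginal y t x * (a : ℝ≥0∞)⁻¹ + ε n * R := by
      intro n
      rw [implicitDensity_eq m r y n t hx]
      refine (lintegral_mono fun past => hle n _).trans_eq ?_
      have hd : Measurable fun past : Fin t → State d =>
          (pathDensity r y t (Fin.snoc (α := fun _ => State d) past x) : ℝ≥0∞) :=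
        (measurable_pathDensity r y t).coe_nnreal_ennreal.comp hs
      rw [lintegral_add_left (hj.mul_const _), lintegral_mul_const _ hj, lintegral_const_mul _ hd]
      rfl
    have hεR : Tendsto (fun n => m.marginal y t x * (a : ℝ≥0∞)⁻¹ + ε n * R) atTop
        (𝓝 (m.marginal y t x * (a : ℝ≥0∞)⁻¹)) := by
      have h := (ENNReal.Tendsto.mul_const hε (Or.inr hRx.ne)).const_add
        (m.marginal y t x * (a : ℝ≥0∞)⁻¹)
      rwa [zero_mul, add_zero] at h
    filter_upwards [hεR.eventually_lt_const hab] with n hn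
    exact (hbound n).trans_lt hn

end AlmostEverywhere

end ParticleFilter

end

theorem corollary1 {d : ℕ} {Y : Type*} [MeasurableSpace Y] {ν : Measure Y}
    (m : ParticleFilter.Model d Y ν) (r : ParticleFilter.Proposal d Y) (y : ℕ → Y) (t : ℕ)
    -- the proposal covers the target
    (hr₀ : ∀ x, m.init x ≠ 0 → r.init x ≠ 0)
    (hr : ∀ s, 1 ≤ s → s ≤ t → ∀ x x',
      m.trans s x x' * m.obs s x' (y s) ≠ 0 → r.step s x (y s) x' ≠ 0)
    -- the conditional densities given the observations are defined
    (hpos : m.likelihood y t ≠ 0) (hfin : ∀ s ≤ t, m.likelihood y s ≠ ∞) :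
    -- the law of the output of SMC with `n + 1` particles has the density `q̃`
    (∀ n, ParticleFilter.outputLaw m r y n t =
      volume.withDensity (ParticleFilter.implicitDensity m r y n t)) ∧
    -- `q̃` converges to the filtering posterior in total variation
    Tendsto (fun n => ∫⁻ x,
      ((ParticleFilter.implicitDensity m r y n t x - m.posterior y t x) +
        (m.posterior y t x - ParticleFilter.implicitDensity m r y n t x))) atTop (𝓝 0) ∧
    -- and almost everywhere, if the weights are bounded
    ((∃ M : ℝ≥0, (∀ x, ParticleFilter.weightInit m r x ≤ M) ∧
        ∀ s, 1 ≤ s → s ≤ t → ∀ x x', ParticleFilter.weight m r y s x x' ≤ M) →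
      ∀ᵐ x, Tendsto (fun n => ParticleFilter.implicitDensity m r y n t x) atTop
        (𝓝 (m.posterior y t x))) := by
  refine ⟨fun n => ParticleFilter.outputLaw_eq_withDensity m r y hr₀ n t hr (hfin t le_rfl),
    ParticleFilter.tendsto_lintegral_implicitDensity m r y hr₀ t hr hpos hfin, ?_⟩
  rintro ⟨M, hM₀, hM⟩
  exact ParticleFilter.ae_tendsto_implicitDensity m r y hr₀ hr hpos hfin hM₀ hM
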